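/- **Conventions.** A feedforward network $\hat c:\mathbb R^d\to\mathbb R^N$ with activation function $\sigma:\mathbb R\to\mathbb R$ is a composition $A_L\circ\sigma\circ A_{L-1}\circ\dots\circ\sigma\circ A_1$ of affine maps $A_1,\dots,A_L$ ($L\ge 1$), where $\sigma$ acts componentwise. The dimensions between two consecutive affine maps are the numbers of neurons of the hidden layers. The *width* is the largest of these numbers, the network has *constant width* $w$ if all of them equal $w$, and $L$ is the *depth*. Call $\sigma$ *regular* if it is continuous, not affine, and there is a point $x_0\in\mathbb R$ at which $\sigma$ is continuously differentiable with $\sigma'(x_0)\neq 0$. Let $\sigma_{\mathrm{sigmoid}}(t)=e^t/(1+e^t)$. For $X\subseteq\mathbb R^d$ and $\gamma\in(0,1)$ the *deep zero-sets* of $\hat c$ are $$\hat K_n=\{x\in X:\ 1-I_{(\gamma,1]}(\sigma_{\mathrm{sigmoid}}(\hat c(x)_n))=0\}=\{x\in X:\ \sigma_{\mathrm{sigmoid}}(\hat c(x)_n)>\gamma\},\qquad n=1,\dots,N.$$ $d_H$ is the Hausdorff distance for the Euclidean norm, with $d_H(K,\emptyset)=\infty$ for $K\ne\emptyset$. **Theorem.**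 Let $d,N$ be non-negative integers. 1. Let $\sigma$ be regular, $X\subseteq\mathbb R^d$ compact, $K_1,\dots,K_N\subseteq X$ non-empty and compact, $\varepsilon>0$ and $\gamma\in(0,1)$. Then there is a network $\hat c:\mathbb R^d\to\mathbb R^N$ with activation function $\sigma$ and width at most $d+N+2$ whose deep zero-sets satisfy $$\max_{n=1,\dots,N} d_H(K_n,\hat K_n)\le\varepsilon .$$ 2. Suppose that $d\ge 2$. There are constants $b,C>0$, depending only on $d$ and $N$, such that for all non-empty compact $K_1,\dots,K_N\subseteq X=[0,1]^d$, all $\varepsilon\in(0,1]$ and all $\gamma\in(0,1)$ there is a network $\hat c:\mathbb R^d\to\mathbb R^N$ with activation function $\sigma(x)=\max\{0,x\}$, constant width $2d+10$ and depth at most $C\,(b\varepsilon)^{-d+1}$ with $\max_{n} d_H(K_n,\hat K_n)\le\varepsilon$. 3. There are constants $b,C>0$, depending only on $d$ and $N$, such that for all regular $\sigma\in C^\infty(\mathbb R)$, all non-empty compact $K_1,\dots,K_N\subseteq X=[0,1]^d$, all $\varepsilon\in(0,1]$ and all $\gamma\in(0,1)$ there is a network $\hat c:\mathbb R^d\to\mathbb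 R^N$ with activation function $\sigma$, constant width $2d+2$ and depth at most $C\,b\,\varepsilon^{-2d}$ with $\max_{n} d_H(K_n,\hat K_n)\le\varepsilon$. -/

import Mathlib

open scoped ContDiff

/-- Feedforward neural networks from `ℝⁿ` to `ℝᵐ`, given by their weights and biases.
`output A b` is the affine map `x ↦ A x + b`. The network `hidden A b rest` first applies the affine
map `x ↦ A x + b` into a hidden layer with `k` neurons, then the activation function componentwise,
then `rest`. Hence the last layer is affine, without activation function. -/
inductive FFNN (m : ℕ) : ℕ → Type
  | output {n : ℕ} (A : Matrix (Fin m) (Fin n) ℝ) (b : Fin m → ℝ) : FFNN m n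
  | hidden {n k : ℕ} (A : Matrix (Fin k) (Fin n) ℝ) (b : Fin k → ℝ) (rest : FFNN m k) : FFNN m n

namespace FFNN

/-- The function realized by a network with activation function `σ`. -/
def eval {m : ℕ} (σ : ℝ → ℝ) : {n : ℕ} → FFNN m n → (Fin n → ℝ) → (Fin m → ℝ)
  | _, output A b, x => A.mulVec x + b
  | _, hidden A b rest, x => eval σ rest (fun i => σ ((A.mulVec x + b) i))

/-- The width: the largest number of neurons in a hidden layer (`0` if there is none). -/
def width {m : ℕ} : {n : ℕ} → FFNN m n → ℕ
  | _, output _ _ => 0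
  | _, hidden (k := k) _ _ rest => max k (width rest)

/-- Every hidden layer has exactly `w` neurons. -/
def HasConstantWidth {m : ℕ} (w : ℕ) : {n : ℕ} → FFNN m n → Prop
  | _, output _ _ => True
  | _, hidden (k := k) _ _ rest => k = w ∧ HasConstantWidth w rest

/-- The depth: the number of affine maps that are composed, i.e. the number of hidden layers plus
one. -/
def depth {m : ℕ} : {n : ℕ} → FFNN m n → ℕ
  | _, output _ _ => 1
  | _, hidden _ _ rest => depth rest + 1

end FFNN

/-- The regularity condition on the activation function: `σ` is continuous and not affine, and there
is a point at which `σ` is continuously differentiable (`σ` is differentiable near the point and its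
derivative is continuous at the point) with non-zero derivative. -/
def IsRegularActivation (σ : ℝ → ℝ) : Prop :=
  Continuous σ ∧ (¬ ∃ a b : ℝ, ∀ x, σ x = a * x + b) ∧
    ∃ x₀ : ℝ, (∀ᶠ x in nhds x₀, DifferentiableAt ℝ σ x) ∧
      ContinuousAt (deriv σ) x₀ ∧ deriv σ x₀ ≠ 0

/-- The `n`-th deep zero-set in `X` of `c : ℝᵈ → ℝᴺ` with threshold `γ`:
`{x ∈ X | 1 - I_{(γ,1]}(σ_sigmoid(c(x)ₙ)) = 0}`, where `I` is the indicator function and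
`σ_sigmoid(t) = eᵗ / (1 + eᵗ) = (1 + e⁻ᵗ)⁻¹`. -/
noncomputable def deepZeroSet {d N : ℕ} (X : Set (EuclideanSpace ℝ (Fin d))) (γ : ℝ)
    (c : EuclideanSpace ℝ (Fin d) → Fin N → ℝ) (n : Fin N) : Set (EuclideanSpace ℝ (Fin d)) :=
  {x ∈ X | 1 - (Set.Ioc γ 1).indicator (fun _ => (1 : ℝ)) (Real.sigmoid (c x n)) = 0}

/-- The unit cube `[0,1]ᵈ` in Euclidean space. -/
def unitCube (d : ℕ) : Set (EuclideanSpace ℝ (Fin d)) :=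
  {x | ∀ i, x i ∈ Set.Icc (0 : ℝ) 1}

/-- The deep zero-sets in `X` with threshold `γ` of the function realized by the network `c` with
activation function `σ` are simultaneously within Hausdorff distance `ε` of `K₁, …, K_N`. The
extended distance is used, so that an empty deep zero-set is at distance `∞` from `Kₙ`. -/
def FFNN.ApproximatesSets {d N : ℕ} (σ : ℝ → ℝ) (c : FFNN N d)
    (X : Set (EuclideanSpace ℝ (Fin d))) (γ : ℝ)
    (K : Fin N → Set (EuclideanSpace ℝ (Fin d))) (ε : ℝ) : Prop :=
  ∀ n, Metric.hausdorffEDist (K n) (deepZeroSet X γ (fun x => c.eval σ x) n) ≤ ENNReal.ofReal ε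

/-!
A set of network maps is studied through its closure in the compact-open topology (`realizable`).
Since strict inequalities on compact sets are open conditions, it suffices to find a limit of
networks which is positive on an `ε`-dense part of each `Kₙ` and negative away from `Kₙ`
(`exists_approximatesSets`). Near a point where `σ' ≠ 0` the activation function is almost affine, so
in the limit each neuron may also apply the identity (`realizable_mix`). Networks are thereby
machines whose registers are transformed by one layer at a time.

*General activation functions.* A shear `y ↦ y + φ (ℓ y + b) • v` with `ℓ v = 0` is realizable for
`φ = σ`, and the admissible profiles `φ` form a closed vector space that is invariant under affine
substitutions. As `σ` is not affine, such a space contains the square: a double moving average of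
`σ` is `C²` with a non-zero second derivative somewhere, and is then blown up at that point
(`sq_mem_of_not_affine`). From squares one gets, using a second register as a scratch register that
is restored afterwards, that the functions which can be added to a register form an algebra
(`IsAddable.sq`), and the Stone–Weierstrass theorem applies. The number of neurons is `d` for the
input, `N` for the outputs, one for the scratch register, and one for the activation function.

*Rates.* Both quantitative statements reduce to interpolation on a grid
(`exists_approximatesSets_of_grid`). The points of a grid with spacing of order `ε` get labels in
`{0, …, N}`, where only every `(N + 1)`-st hyperplane of the grid is available for a given `Kₙ`, so that
labels for different sets do not compete. If `G ≥ 0` vanishes exactly on the grid and `s`, `q`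
interpolate the label and its square there, then
`2 (n + 1) s - q - (n + 1)² + 1 / 2 - Λ G` with large `Λ` is positive at the points with label
`n + 1` and negative away from `Kₙ`. This uses two output registers for all `n`, and no estimate of
`s` and `q` off the grid is needed.

For the ReLU function, the labels in each column of the grid are the binary digits of an integer.
The code of the column is interpolated with one layer per column, that is, with `O(ε^(-d + 1))`
layers, and then its digits are extracted one after the other (`exists_reluRealizable_grid`).

For smooth `σ`, squares of registers can be formed without any additional neuron
(`realizable_add_sq`), hence products, and polynomials are evaluated by Horner's scheme. The penalty
is a sum of squares of polynomials in one variable, and the labels are interpolated by a polynomial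
of one variable in the number of the grid point (`exists_smoothRealizable_grid`), which takes
`O(ε^(-d))` layers.
-/

/-! ### Networks as register machines -/

/-- The maps from `ℝᵈ` to `κ → ℝ` that are computed by `T` hidden layers, each with neurons indexed
by `ι`, followed by an affine map. The recursion peels off the last hidden layer, so that a network
is extended by further layers at its end. The values of the last affine map are thought of as the
registers of a machine after `T` steps. -/
def networkMaps (σ : C(ℝ, ℝ)) (d : ℕ) (ι : Type) :
    ℕ → (κ : Type) → Set C(EuclideanSpace ℝ (Fin d), κ → ℝ)
  | 0, κ => {f | ∃ (L : EuclideanSpace ℝ (Fin d) →ₗ[ℝ] (κ → ℝ)) (b : κ → ℝ), ∀ x, f x = L x + b}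
  | T + 1, κ => {f | ∃ g ∈ networkMaps σ d ι T ι, ∃ (L : (ι → ℝ) →ₗ[ℝ] (κ → ℝ)) (b : κ → ℝ),
      ∀ x, f x = L (fun i => σ (g x i)) + b}

namespace FFNN

theorem width_le_of_hasConstantWidth {m w n : ℕ} (c : FFNN m n) (h : c.HasConstantWidth w) :
    c.width ≤ w := by
  induction c with
  | output A b => simp [width]
  | hidden A b rest ih =>
    obtain ⟨rfl, h2⟩ := h
    simpa [width] using ih h2

/-- An affine map can be absorbed into the first layer of a network. -/
theorem exists_eval_comp_affine {m w n p : ℕ} (σ : ℝ → ℝ) (c : FFNN m n)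
    (hc : c.HasConstantWidth w) (L : (Fin p → ℝ) →ₗ[ℝ] (Fin n → ℝ)) (v : Fin n → ℝ) :
    ∃ c' : FFNN m p, c'.HasConstantWidth w ∧ c'.depth = c.depth ∧
      ∀ x, c'.eval σ x = c.eval σ (L x + v) := by
  cases c with
  | output A b =>
    refine ⟨output (A * L.toMatrix') (A.mulVec v + b), trivial, rfl, fun x => ?_⟩
    simp [eval, ← Matrix.mulVec_mulVec, LinearMap.toMatrix'_mulVec, Matrix.mulVec_add, add_assoc]
  | hidden A b rest =>
    refine ⟨hidden (A * L.toMatrix') (A.mulVec v + b) rest, hc, rfl, fun x => ?_⟩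
    simp [eval, ← Matrix.mulVec_mulVec, LinearMap.toMatrix'_mulVec, Matrix.mulVec_add, add_assoc]

/-- Prepending the hidden layers of an element of `networkMaps` to a network. If there are fewer
than `w` neurons in `ι`, the superfluous neurons carry `0` before the activation and are ignored
afterwards. -/
theorem exists_eval_comp_networkMaps {d w m : ℕ} {σ : C(ℝ, ℝ)} {ι : Type} [Fintype ι]
    (e : ι ↪ Fin w) :
    ∀ (T : ℕ) (g : C(EuclideanSpace ℝ (Fin d), ι → ℝ)), g ∈ networkMaps σ d ι T ι →
    ∀ c : FFNN m w, c.HasConstantWidth w → ∃ c' : FFNN m d, c'.HasConstantWidth w ∧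
      c'.depth = c.depth + T ∧
      ∀ x : EuclideanSpace ℝ (Fin d),
        c'.eval σ x = c.eval σ (Function.ExtendByZero.linearMap ℝ e (g x)) := by
  intro T
  induction T with
  | zero =>
    rintro g ⟨L, b, hg⟩ c hc
    obtain ⟨c', h1, h2, h3⟩ := exists_eval_comp_affine σ c hc
      (Function.ExtendByZero.linearMap ℝ e ∘ₗ L ∘ₗ
        (WithLp.linearEquiv 2 ℝ (Fin d → ℝ)).symm.toLinearMap)
      (Function.ExtendByZero.linearMap ℝ e b)
    refine ⟨c', h1, by simpa using h2, fun x => ?_⟩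
    rw [h3, hg, map_add]
    rfl
  | succ T ih =>
    rintro f ⟨g, hg, L, b, hf⟩ c hc
    obtain ⟨c₁, h1, h2, h3⟩ := exists_eval_comp_affine σ c hc
      (Function.ExtendByZero.linearMap ℝ e ∘ₗ L ∘ₗ LinearMap.funLeft ℝ ℝ e)
      (Function.ExtendByZero.linearMap ℝ e b)
    obtain ⟨c₂, k1, k2, k3⟩ := ih g hg (hidden (1 : Matrix (Fin w) (Fin w) ℝ) 0 c₁) ⟨rfl, h1⟩
    refine ⟨c₂, k1, ?_, fun x => ?_⟩
    · rw [k2, depth, h2]; ring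
    · rw [k3, eval, h3, hf, map_add]
      simp only [LinearMap.comp_apply, Matrix.one_mulVec, add_zero]
      congr 4
      funext i
      simp [LinearMap.funLeft_apply, Function.ExtendByZero.linearMap_apply,
        e.injective.extend_apply]

/-- Elements of `networkMaps` are realized by networks of constant width. -/
theorem exists_eval_eq {d w N T : ℕ} {σ : C(ℝ, ℝ)} {ι : Type} [Fintype ι] (e : ι ↪ Fin w)
    {g : C(EuclideanSpace ℝ (Fin d), Fin N → ℝ)} (hg : g ∈ networkMaps σ d ι T (Fin N))
    (v : Fin N → ℝ) :
    ∃ c : FFNN N d, c.HasConstantWidth w ∧ c.depth = T + 1 ∧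
      ∀ x : EuclideanSpace ℝ (Fin d), c.eval σ x = g x + v := by
  cases T with
  | zero =>
    obtain ⟨L, b, hg⟩ := hg
    refine ⟨output (L ∘ₗ (WithLp.linearEquiv 2 ℝ (Fin d → ℝ)).symm.toLinearMap).toMatrix' (b + v),
      trivial, rfl, fun x => ?_⟩
    rw [eval, LinearMap.toMatrix'_mulVec, hg, ← add_assoc]
    rfl
  | succ T =>
    obtain ⟨g', hg', L, b, hg⟩ := hg
    obtain ⟨c₂, k1, k2, k3⟩ := exists_eval_comp_networkMaps e T g' hg'
      (hidden (1 : Matrix (Fin w) (Fin w) ℝ) 0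
        (output (L ∘ₗ LinearMap.funLeft ℝ ℝ e).toMatrix' (b + v))) ⟨rfl, trivial⟩
    refine ⟨c₂, k1, by rw [k2, depth, depth]; ring, fun x => ?_⟩
    rw [k3, eval, eval, LinearMap.toMatrix'_mulVec, hg, ← add_assoc]
    simp only [LinearMap.comp_apply, Matrix.one_mulVec, add_zero]
    congr 3
    funext i
    simp [LinearMap.funLeft_apply, Function.ExtendByZero.linearMap_apply,
      e.injective.extend_apply]

end FFNN

/-! ### Separating maps and deep zero-sets -/

open Set in
/-- Strict inequalities on compact sets define an open set of maps in the compact-open topology, so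
they are inherited from an element of the closure. -/
theorem exists_mem_of_mem_closure_of_separates {E : Type*} [TopologicalSpace E] {N : ℕ}
    {S : Set C(E, Fin N → ℝ)} {f : C(E, Fin N → ℝ)} (hf : f ∈ closure S) {P Q : Fin N → Set E}
    (hP : ∀ n, IsCompact (P n)) (hQ : ∀ n, IsCompact (Q n)) (hfP : ∀ n, ∀ x ∈ P n, 0 < f x n)
    (hfQ : ∀ n, ∀ x ∈ Q n, f x n < 0) :
    ∃ g ∈ S, ∀ n, (∀ x ∈ P n, 0 < g x n) ∧ ∀ x ∈ Q n, g x n < 0 := by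
  have h1 : ∀ n, ∀ᶠ g : C(E, Fin N → ℝ) in nhds f, MapsTo g (P n) {y | 0 < y n} := fun n =>
    ContinuousMap.eventually_mapsTo (hP n)
      (isOpen_lt continuous_const (continuous_apply n)) (fun x hx => hfP n x hx)
  have h2 : ∀ n, ∀ᶠ g : C(E, Fin N → ℝ) in nhds f, MapsTo g (Q n) {y | y n < 0} := fun n =>
    ContinuousMap.eventually_mapsTo (hQ n)
      (isOpen_lt (continuous_apply n) continuous_const) (fun x hx => hfQ n x hx)
  have h3 := (Filter.eventually_all.2 h1).and (Filter.eventually_all.2 h2)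
  obtain ⟨g, hgS, hg1, hg2⟩ := ((mem_closure_iff_frequently.1 hf).and_eventually h3).exists
  exact ⟨g, hgS, fun n => ⟨fun x hx => hg1 n hx, fun x hx => hg2 n hx⟩⟩

theorem mem_deepZeroSet_iff {d N : ℕ} {X : Set (EuclideanSpace ℝ (Fin d))} {γ θ : ℝ}
    (hθ : Real.sigmoid θ = γ) {c : EuclideanSpace ℝ (Fin d) → Fin N → ℝ} {n : Fin N}
    {x : EuclideanSpace ℝ (Fin d)} : x ∈ deepZeroSet X γ c n ↔ x ∈ X ∧ θ < c x n := by
  simp only [deepZeroSet, Set.mem_ofPred_eq, and_congr_right_iff]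
  intro _
  by_cases h : θ < c x n
  · have : Real.sigmoid (c x n) ∈ Set.Ioc γ 1 :=
      ⟨by rw [← hθ]; exact Real.sigmoid_lt h, Real.sigmoid_le_one _⟩
    simp [h, Set.indicator_of_mem this]
  · have : Real.sigmoid (c x n) ∉ Set.Ioc γ 1 := fun h' => h (by
      have := h'.1
      rwa [← hθ, Real.sigmoid_lt_iff] at this)
    simp [h, Set.indicator_of_notMem this]

/-- A map in the closure of the network maps that is positive on compact sets `Pₙ ⊆ X` which are
`ε`-dense in `Kₙ`, and negative on the points of `X` at distance at least `ε` from `Kₙ`, yields a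
network whose deep zero-sets are within Hausdorff distance `ε` of the `Kₙ`. -/
theorem exists_approximatesSets {d N w : ℕ} {σ : C(ℝ, ℝ)} {ι : Type} [Fintype ι] (e : ι ↪ Fin w)
    {S : Set ℕ} {f : C(EuclideanSpace ℝ (Fin d), Fin N → ℝ)}
    (hf : f ∈ closure (⋃ T ∈ S, networkMaps σ d ι T (Fin N)))
    {X : Set (EuclideanSpace ℝ (Fin d))} (hX : IsCompact X)
    {K P : Fin N → Set (EuclideanSpace ℝ (Fin d))} (hK : ∀ n, (K n).Nonempty)
    {ε γ : ℝ} (hγ : γ ∈ Set.Ioo (0 : ℝ) 1)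
    (hP : ∀ n, IsCompact (P n)) (hPX : ∀ n, P n ⊆ X)
    (hKP : ∀ n, ∀ x ∈ K n, ∃ y ∈ P n, dist x y ≤ ε) (hfP : ∀ n, ∀ x ∈ P n, 0 < f x n)
    (hfX : ∀ n, ∀ x ∈ X, ε ≤ Metric.infDist x (K n) → f x n < 0) :
    ∃ c : FFNN N d, c.HasConstantWidth w ∧ (∃ T ∈ S, c.depth = T + 1) ∧
      c.ApproximatesSets σ X γ K ε := by
  obtain ⟨θ, hθ⟩ : γ ∈ Set.range Real.sigmoid := by rwa [Real.range_sigmoid]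
  obtain ⟨g, hg, hgPQ⟩ := exists_mem_of_mem_closure_of_separates hf hP
    (Q := fun n => X ∩ {x | ε ≤ Metric.infDist x (K n)})
    (fun n => hX.inter_right
      (isClosed_le continuous_const (Metric.continuous_infDist_pt _)))
    hfP (fun n x hx => hfX n x hx.1 hx.2)
  simp only [Set.mem_iUnion] at hg
  obtain ⟨T, hT, hg⟩ := hg
  obtain ⟨c, h1, h2, h3⟩ := FFNN.exists_eval_eq e hg (fun _ => θ)
  refine ⟨c, h1, ⟨T, hT, h2⟩, fun n => ?_⟩
  refine Metric.hausdorffEDist_le_of_mem_edist (fun x hx => ?_) (fun x hx => ?_)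
  · obtain ⟨y, hy, hxy⟩ := hKP n x hx
    refine ⟨y, (mem_deepZeroSet_iff hθ).2 ⟨hPX n hy, ?_⟩, ?_⟩
    · rw [h3]
      simpa using (hgPQ n).1 y hy
    · rw [edist_dist]; exact ENNReal.ofReal_le_ofReal hxy
  · obtain ⟨hxX, hx⟩ := (mem_deepZeroSet_iff hθ).1 hx
    rw [h3] at hx
    have hlt : Metric.infDist x (K n) < ε := by
      by_contra! h
      have := (hgPQ n).2 x ⟨hxX, h⟩
      simp only [Pi.add_apply] at hx
      linarith
    obtain ⟨y, hy, hxy⟩ := (Metric.infDist_lt_iff (hK n)).1 hlt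
    exact ⟨y, hy, by rw [edist_dist]; exact ENNReal.ofReal_le_ofReal hxy.le⟩

/-! ### Layers that mix the activation function with the identity -/

/-- The maps `ℝᵈ → (κ → ℝ)` that are limits, uniformly on compact sets, of networks with neurons
indexed by `ι` and a number of hidden layers in `S`. -/
def realizable (σ : C(ℝ, ℝ)) (d : ℕ) (ι : Type) (S : Set ℕ) (κ : Type) :
    Set C(EuclideanSpace ℝ (Fin d), κ → ℝ) :=
  closure (⋃ T ∈ S, networkMaps σ d ι T κ)

section Layers

variable {σ : C(ℝ, ℝ)} {d : ℕ} {ι κ κ' : Type} {S S' : Set ℕ}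

theorem networkMaps_subset_realizable {T : ℕ} (hT : T ∈ S) :
    networkMaps σ d ι T κ ⊆ realizable σ d ι S κ :=
  fun _ hf => subset_closure (Set.mem_biUnion hT hf)

theorem isClosed_realizable : IsClosed (realizable σ d ι S κ) := isClosed_closure

/-- A state that is affine in the input needs no hidden layer. -/
theorem affine_mem_realizable (hS : 0 ∈ S) (L : EuclideanSpace ℝ (Fin d) →ₗ[ℝ] (κ → ℝ))
    (b : κ → ℝ) {f : C(EuclideanSpace ℝ (Fin d), κ → ℝ)} (hf : ∀ x, f x = L x + b) :
    f ∈ realizable σ d ι S κ :=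
  networkMaps_subset_realizable hS ⟨L, b, hf⟩

theorem networkMaps_affine {T : ℕ} {f : C(EuclideanSpace ℝ (Fin d), κ → ℝ)}
    (hf : f ∈ networkMaps σ d ι T κ) (L : (κ → ℝ) →ₗ[ℝ] (κ' → ℝ)) (b : κ' → ℝ)
    {g : C(EuclideanSpace ℝ (Fin d), κ' → ℝ)} (hg : ∀ x, g x = L (f x) + b) :
    g ∈ networkMaps σ d ι T κ' := by
  cases T with
  | zero =>
    obtain ⟨L', b', hf⟩ := hf
    exact ⟨L ∘ₗ L', L b' + b, fun x => by rw [hg, hf, map_add, add_assoc]; rfl⟩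
  | succ T =>
    obtain ⟨f', hf', L', b', hf⟩ := hf
    exact ⟨f', hf', L ∘ₗ L', L b' + b, fun x => by rw [hg, hf, map_add, add_assoc]; rfl⟩

theorem realizable_of_comp {G : C(κ → ℝ, κ' → ℝ)}
    (h : ∀ T ∈ S, ∀ f ∈ networkMaps σ d ι T κ, G.comp f ∈ realizable σ d ι S' κ')
    {f : C(EuclideanSpace ℝ (Fin d), κ → ℝ)} (hf : f ∈ realizable σ d ι S κ) :
    G.comp f ∈ realizable σ d ι S' κ' := by
  have := map_mem_closure (t := realizable σ d ι S' κ') G.continuous_postcomp hf (fun f hf => by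
    simp only [Set.mem_iUnion] at hf
    obtain ⟨T, hT, hf⟩ := hf
    exact h T hT f hf)
  rwa [isClosed_realizable.closure_eq] at this

theorem realizable_affine [Finite κ] {f : C(EuclideanSpace ℝ (Fin d), κ → ℝ)}
    (hf : f ∈ realizable σ d ι S κ) (L : (κ → ℝ) →ₗ[ℝ] (κ' → ℝ)) (b : κ' → ℝ)
    {g : C(EuclideanSpace ℝ (Fin d), κ' → ℝ)} (hg : ∀ x, g x = L (f x) + b) :
    g ∈ realizable σ d ι S κ' := by
  have hc : Continuous fun y => L y + b :=
    (continuous_pi fun i => ((LinearMap.proj i ∘ₗ L).continuous_on_pi)).add continuous_const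
  have := realizable_of_comp (G := ⟨_, hc⟩) (S' := S) (fun T hT f hf =>
    networkMaps_subset_realizable hT (networkMaps_affine hf L b fun x => rfl)) hf
  convert this using 1
  ext1 x
  exact hg x

/-- Parametrized families of continuous maps are continuous in the parameter; hence a realizable
family that is parametrized by the non-zero reals and extends continuously to `0` has a realizable
limit. -/
theorem realizable_of_punctured {Φ : ℝ × EuclideanSpace ℝ (Fin d) → κ → ℝ} (hΦ : Continuous Φ)
    (h : ∀ t ≠ 0, ∀ g : C(EuclideanSpace ℝ (Fin d), κ → ℝ), (∀ x, g x = Φ (t, x)) →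
      g ∈ realizable σ d ι S κ)
    {g : C(EuclideanSpace ℝ (Fin d), κ → ℝ)} (hg : ∀ x, g x = Φ (0, x)) :
    g ∈ realizable σ d ι S κ := by
  let F : C(ℝ, C(EuclideanSpace ℝ (Fin d), κ → ℝ)) := ContinuousMap.curry ⟨Φ, hΦ⟩
  have h0 : g = F 0 := by ext1 x; exact hg x
  rw [h0]
  refine isClosed_realizable.mem_of_tendsto
    ((F.continuous.tendsto 0).mono_left (nhdsWithin_le_nhds (s := {0}ᶜ))) ?_
  filter_upwards [self_mem_nhdsWithin] with t ht
  exact h t ht _ fun x => rfl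

theorem continuous_dslope {f : ℝ → ℝ} {a : ℝ} (hf : Continuous f) (ha : DifferentiableAt ℝ f a) :
    Continuous (dslope f a) :=
  continuous_iff_continuousAt.2 fun b => by
    rcases eq_or_ne b a with rfl | hb
    · exact continuousAt_dslope_same.2 ha
    · exact (continuousAt_dslope_of_ne hb).2 hf.continuousAt

/-- If `σ` has a non-zero derivative at some point, then a layer in which some neurons (those in
`J`) apply `σ` and the others apply the identity is a limit of layers all of whose neurons apply
`σ`: near that point, `σ` is almost affine. -/
theorem realizable_mix [Finite κ] {x₀ : ℝ} (hσ : DifferentiableAt ℝ σ x₀) (hσ' : deriv σ x₀ ≠ 0)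
    (hS : ∀ T ∈ S, T + 1 ∈ S') {f : C(EuclideanSpace ℝ (Fin d), κ → ℝ)}
    (hf : f ∈ realizable σ d ι S κ) (J : ι → Prop) [DecidablePred J]
    (L : (κ → ℝ) →ₗ[ℝ] (ι → ℝ)) (b : ι → ℝ) {g : C(EuclideanSpace ℝ (Fin d), ι → ℝ)}
    (hg : ∀ x i, g x i = if J i then σ ((L (f x) + b) i) else (L (f x) + b) i) :
    g ∈ realizable σ d ι S' ι := by
  have hL : Continuous fun y => L y + b :=
    (continuous_pi fun i => ((LinearMap.proj i ∘ₗ L).continuous_on_pi)).add continuous_const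
  have hLi : ∀ i, Continuous fun y => L y i + b i := fun i => (continuous_apply i).comp hL
  have hG : Continuous fun y i => if J i then σ ((L y + b) i) else (L y + b) i := by
    refine continuous_pi fun i => ?_
    split_ifs
    · exact σ.continuous.comp (hLi i)
    · exact hLi i
  have key := realizable_of_comp (σ := σ) (d := d) (ι := ι) (S := S) (G := ⟨_, hG⟩) (S' := S')
    (fun T hT f hf => ?_) hf
  · convert key using 1
    ext x i
    exact hg x i
  have hds := continuous_dslope σ.continuous hσ
  refine realizable_of_punctured (Φ := fun p i => if J i then σ ((L (f p.2) + b) i) else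
    (L (f p.2) + b) i * dslope σ x₀ (x₀ + p.1 * (L (f p.2) + b) i) / deriv σ x₀) ?_ ?_ ?_
  · refine continuous_pi fun i => ?_
    have h1 : Continuous fun p : ℝ × EuclideanSpace ℝ (Fin d) => (L (f p.2) + b) i :=
      (hLi i).comp (f.continuous.comp continuous_snd)
    split_ifs
    · exact σ.continuous.comp h1
    · exact (h1.mul (hds.comp (continuous_const.add (continuous_fst.mul h1)))).div_const _
  · intro t ht g hg
    let D : (ι → ℝ) →ₗ[ℝ] (ι → ℝ) := LinearMap.pi fun i =>
      (if J i then (1 : ℝ) else t) • LinearMap.proj i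
    let D' : (ι → ℝ) →ₗ[ℝ] (ι → ℝ) := LinearMap.pi fun i =>
      (if J i then (1 : ℝ) else (t * deriv σ x₀)⁻¹) • LinearMap.proj i
    have hD : Continuous D := continuous_pi fun i =>
      (continuous_const.mul (continuous_apply i))
    let v : ι → ℝ := fun i => if J i then 0 else x₀
    have hf' := networkMaps_affine (κ' := ι) hf (D ∘ₗ L) (D b + v)
      (g := ⟨fun x => D (L (f x) + b) + v,
        (hD.comp (hL.comp f.continuous)).add continuous_const⟩)
      (fun x => by
        change D (L (f x) + b) + v = D (L (f x)) + (D b + v)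
        rw [map_add, add_assoc])
    refine networkMaps_subset_realizable (hS T hT) ⟨_, hf', D',
      fun i => if J i then 0 else - σ x₀ * (t * deriv σ x₀)⁻¹, fun x => ?_⟩
    rw [hg]
    funext i
    by_cases hi : J i
    · simp [hi, D, D', v]
    · have := sub_smul_dslope σ x₀ (x₀ + t * (L (f x) + b) i)
      simp only [add_sub_cancel_left, smul_eq_mul] at this
      simp only [hi, if_false, D, D', v, LinearMap.pi_apply, LinearMap.smul_apply,
        LinearMap.proj_apply, smul_eq_mul, Pi.add_apply, ContinuousMap.coe_mk] at this ⊢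
      rw [add_comm _ x₀, eq_add_of_sub_eq this.symm]
      field_simp
      ring
  · intro x
    funext i
    change (if J i then _ else _) = _
    simp [dslope_same, hσ']

/-- With neurons `μ` besides those that carry the registers `κ`, a layer can apply an affine map to the
registers and add linear combinations of values of the activation function at affine functions of
the registers. -/
theorem realizable_add_activations {μ : Type} [Fintype κ] [Fintype μ] {x₀ : ℝ}
    (hσ : DifferentiableAt ℝ σ x₀) (hσ' : deriv σ x₀ ≠ 0) (hS : ∀ T ∈ S, T + 1 ∈ S')
    {f : C(EuclideanSpace ℝ (Fin d), κ → ℝ)} (hf : f ∈ realizable σ d (κ ⊕ μ) S κ)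
    (ℓ : μ → (κ → ℝ) →ₗ[ℝ] ℝ) (β : μ → ℝ) (v : μ → κ → ℝ)
    (L : (κ → ℝ) →ₗ[ℝ] (κ → ℝ)) (b : κ → ℝ) {g : C(EuclideanSpace ℝ (Fin d), κ → ℝ)}
    (hg : ∀ x, g x = L (f x) + b + ∑ m, σ (ℓ m (f x) + β m) • v m) :
    g ∈ realizable σ d (κ ⊕ μ) S' κ := by
  have hc : Continuous fun x => Sum.elim (f x) fun m => σ (ℓ m (f x) + β m) :=
    continuous_pi fun i => by
      rcases i with i | m
      · exact (continuous_apply i).comp f.continuous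
      · exact σ.continuous.comp (((ℓ m).continuous_on_pi.comp f.continuous).add continuous_const)
  have h1 := realizable_mix hσ hσ' hS hf (fun i => i.isRight = true)
    (LinearMap.pi (Sum.elim LinearMap.proj ℓ)) (Sum.elim 0 β) (g := ⟨_, hc⟩)
    (fun x i => by rcases i with i | m <;> simp)
  refine realizable_affine h1 (L ∘ₗ LinearMap.funLeft ℝ ℝ Sum.inl +
    ∑ m, LinearMap.smulRight (LinearMap.proj (Sum.inr m)) (v m)) b fun x => ?_
  rw [hg, add_right_comm]
  simp [LinearMap.funLeft, Function.comp_def]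

end Layers

/-! ### Second-order expansions -/

/-- The difference quotient of a `C²` function at `a` is differentiable at `a`, with half of the
second derivative. -/
theorem hasDerivAt_dslope_self {f : ℝ → ℝ} (hf : ContDiff ℝ 2 f) (a : ℝ) :
    HasDerivAt (dslope f a) (deriv (deriv f) a / 2) a := by
  have h := Real.taylor_tendsto (n := 2) convex_univ (Set.mem_univ a) hf.contDiffOn
  simp only [taylorWithinEval_succ, taylor_within_zero_eval, iteratedDerivWithin_univ,
    iteratedDeriv_succ, iteratedDeriv_zero, nhdsWithin_univ] at h
  rw [hasDerivAt_iff_tendsto_slope]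
  have h3 := (h.mono_left (nhdsWithin_le_nhds (s := {a}ᶜ))).add
    (tendsto_const_nhds (x := deriv (deriv f) a / 2))
  simp only [zero_add (deriv (deriv f) a / 2)] at h3
  refine h3.congr' ?_
  filter_upwards [self_mem_nhdsWithin] with x hx
  have hx' : x - a ≠ 0 := sub_ne_zero.2 hx
  rw [slope_def_field, dslope_same, dslope_of_ne _ hx, slope_def_field]
  simp
  field_simp
  ring

/-- The second-order remainder of `f` at `a`, normalized so that
`f (a + t) = f a + f' a * t + f'' a / 2 * t² * secondRemainder f a t`. -/
noncomputable def secondRemainder (f : ℝ → ℝ) (a t : ℝ) : ℝ :=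
  dslope (dslope f a) a (a + t) * 2 / deriv (deriv f) a

section

variable {f : ℝ → ℝ} {a : ℝ}

theorem continuous_secondRemainder (hf : ContDiff ℝ 2 f) :
    Continuous (secondRemainder f a) := by
  have h1 : Continuous (dslope f a) :=
    continuous_dslope hf.continuous (hf.differentiable (by norm_num) a)
  exact (((continuous_dslope h1 (hasDerivAt_dslope_self hf a).differentiableAt).comp
    (continuous_const.add continuous_id)).mul continuous_const).div_const _

theorem secondRemainder_zero (hf : ContDiff ℝ 2 f) (h2 : deriv (deriv f) a ≠ 0) :
    secondRemainder f a 0 = 1 := by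
  rw [secondRemainder, add_zero, dslope_same, (hasDerivAt_dslope_self hf a).deriv]
  field_simp

theorem sq_mul_secondRemainder (h2 : deriv (deriv f) a ≠ 0) (t : ℝ) :
    deriv (deriv f) a / 2 * (t ^ 2 * secondRemainder f a t) = f (a + t) - f a - deriv f a * t := by
  have h3 := sub_smul_dslope (dslope f a) a (a + t)
  have h4 := sub_smul_dslope f a (a + t)
  simp only [add_sub_cancel_left, smul_eq_mul, dslope_same] at h3 h4
  rw [← h4, secondRemainder]
  field_simp
  linear_combination t * h3

end

/-! ### Invariant subspaces of continuous functions contain the square -/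

/-- A continuous function whose second differences with positive step vanish is affine. -/
theorem exists_affine_of_second_difference_eq_zero {φ : ℝ → ℝ} (hφ : Continuous φ)
    (h : ∀ x t, 0 < t → φ (x + 2 * t) - 2 * φ (x + t) + φ x = 0) :
    ∃ a b : ℝ, ∀ x, φ x = a * x + b := by
  have hmid : ∀ x y, φ (midpoint ℝ x y) = midpoint ℝ (φ x) (φ y) := by
    have aux : ∀ x y, x < y → φ (midpoint ℝ x y) = midpoint ℝ (φ x) (φ y) := fun x y hxy => by
      have := h x ((y - x) / 2) (by linarith)
      rw [midpoint_eq_smul_add, midpoint_eq_smul_add]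
      simp only [smul_eq_mul, invOf_eq_inv]
      rw [show x + 2 * ((y - x) / 2) = y by ring,
        show x + (y - x) / 2 = 2⁻¹ * (x + y) by ring] at this
      linarith
    intro x y
    rcases lt_trichotomy x y with hxy | rfl | hxy
    · exact aux x y hxy
    · simp
    · rw [midpoint_comm, aux y x hxy, midpoint_comm]
  let A := AffineMap.ofMapMidpoint φ hmid hφ
  refine ⟨A.linear 1, A 0, fun x => ?_⟩
  have h1 : φ x = A x := rfl
  have h2 : A x = A.linear x + A 0 := by
    have := A.map_vadd 0 x
    simpa using this
  have h3 : A.linear x = x * A.linear 1 := by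
    have := A.linear.map_smul x 1
    simpa using this
  rw [h1, h2, h3]; ring

/-- A moving average is a limit, uniformly on compact sets, of averages of finitely many
translates. -/
theorem average_mem_of_translates_mem {F : Submodule ℝ C(ℝ, ℝ)} (hF : IsClosed (F : Set C(ℝ, ℝ)))
    {φ : C(ℝ, ℝ)} (htr : ∀ s : ℝ, φ.comp ⟨fun x => x + s, by fun_prop⟩ ∈ F) {h : ℝ} (hh : 0 < h)
    {ψ : C(ℝ, ℝ)} (hψ : ∀ x, ψ x = ∫ s in x..x + h, φ s) : ψ ∈ F := by
  let G : ℕ → C(ℝ, ℝ) := fun n => ∑ i ∈ Finset.range (n + 1),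
    (h / (n + 1)) • φ.comp ⟨fun x => x + i * (h / (n + 1)), by fun_prop⟩
  have hG : ∀ n, G n ∈ F := fun n => F.sum_mem fun i _ => F.smul_mem _ (htr _)
  refine hF.mem_of_tendsto (f := G) (b := Filter.atTop) ?_ (Filter.Eventually.of_forall hG)
  rw [ContinuousMap.tendsto_iff_forall_isCompact_tendstoUniformlyOn]
  intro K hK
  obtain ⟨R, hR⟩ := hK.isBounded.subset_closedBall 0
  have huc := (isCompact_Icc (a := -R) (b := R + h)).uniformContinuousOn_of_continuous
    φ.continuous.continuousOn
  rw [Metric.tendstoUniformlyOn_iff]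
  intro ε hε
  obtain ⟨δ, hδ, hφδ⟩ := Metric.uniformContinuousOn_iff_le.1 huc (ε / (2 * h)) (by positivity)
  have hlim : Filter.Tendsto (fun n : ℕ => h / ((n : ℝ) + 1)) Filter.atTop (nhds 0) :=
    tendsto_const_nhds.div_atTop (Filter.tendsto_atTop_add_const_right _ _
      tendsto_natCast_atTop_atTop)
  filter_upwards [hlim.eventually (gt_mem_nhds hδ)] with n hn x hx
  have hxR := hR hx
  rw [Metric.mem_closedBall, dist_zero_right, Real.norm_eq_abs, abs_le] at hxR
  set η := h / ((n : ℝ) + 1) with hη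
  have hη0 : 0 < η := by positivity
  have hηn : ((n : ℝ) + 1) * η = h := by rw [hη]; field_simp
  have hsum : ψ x = ∑ i ∈ Finset.range (n + 1),
      ∫ s in (x + (i : ℕ) * η)..(x + ((i + 1 : ℕ) : ℕ) * η), φ s := by
    rw [intervalIntegral.sum_integral_adjacent_intervals
      (a := fun i : ℕ => x + i * η) fun i _ => φ.continuous.intervalIntegrable _ _, hψ]
    congr 1
    · simp
    · push_cast; rw [hηn]
  have hGx : G n x = ∑ i ∈ Finset.range (n + 1), η * φ (x + i * η) := by
    simp [G, hη]
  rw [hsum, hGx, Real.dist_eq, ← Finset.sum_sub_distrib]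
  have hterm : ∀ i ∈ Finset.range (n + 1),
      |(∫ s in (x + (i : ℕ) * η)..(x + ((i + 1 : ℕ) : ℕ) * η), φ s) - η * φ (x + i * η)|
        ≤ ε / (2 * h) * η := by
    intro i hi
    have hi' : ((i : ℝ) + 1) * η ≤ h := by
      rw [← hηn]
      have : (i : ℝ) + 1 ≤ n + 1 := by
        exact_mod_cast Finset.mem_range.1 hi
      gcongr
    have hle : x + (i : ℝ) * η ≤ x + ((i + 1 : ℕ) : ℝ) * η := by
      push_cast; nlinarith
    have hi0 : 0 ≤ (i : ℝ) * η := by positivity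
    have heq : (∫ s in (x + (i : ℕ) * η)..(x + ((i + 1 : ℕ) : ℕ) * η), φ s) - η * φ (x + i * η)
        = ∫ s in (x + (i : ℕ) * η)..(x + ((i + 1 : ℕ) : ℕ) * η), (φ s - φ (x + i * η)) := by
      rw [intervalIntegral.integral_sub (φ.continuous.intervalIntegrable _ _)
        intervalIntegrable_const, intervalIntegral.integral_const]
      push_cast
      simp only [smul_eq_mul]
      ring
    rw [heq, ← Real.norm_eq_abs]
    refine (intervalIntegral.norm_integral_le_of_norm_le_const (C := ε / (2 * h))
      fun s hs => ?_).trans_eq ?_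
    · rw [Set.uIoc_of_le hle] at hs
      have hs2 := hs.2
      push_cast at hs2
      rw [← dist_eq_norm]
      refine hφδ _ ⟨by linarith [hs.1], by linarith⟩ _ ⟨by linarith, by linarith⟩ ?_
      rw [Real.dist_eq, abs_of_nonneg (by linarith [hs.1])]
      linarith
    · push_cast
      rw [abs_of_nonneg (by linarith)]
      ring
  calc _ ≤ _ := Finset.abs_sum_le_sum_abs _ _
    _ ≤ ∑ i ∈ Finset.range (n + 1), ε / (2 * h) * η := Finset.sum_le_sum hterm
    _ = ε / (2 * h) * (((n : ℝ) + 1) * η) := by simp; ring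
    _ = ε / 2 := by rw [hηn]; field_simp
    _ < ε := by linarith

/-- A closed subspace of `C(ℝ, ℝ)` that is invariant under affine substitutions and contains all
constants, the identity and a function that is not affine contains the square. -/
theorem sq_mem_of_not_affine {F : Submodule ℝ C(ℝ, ℝ)} (hF : IsClosed (F : Set C(ℝ, ℝ)))
    (hsub : ∀ φ ∈ F, ∀ a b : ℝ, φ.comp ⟨fun x => a * x + b, by fun_prop⟩ ∈ F)
    (hone : ContinuousMap.const ℝ (1 : ℝ) ∈ F) (hid : ContinuousMap.id ℝ ∈ F)
    {φ : C(ℝ, ℝ)} (hφF : φ ∈ F) (hφ : ¬ ∃ a b : ℝ, ∀ x, φ x = a * x + b)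
    {q : C(ℝ, ℝ)} (hq : ∀ x, q x = x ^ 2) : q ∈ F := by
  obtain ⟨x₁, h, hh, hne⟩ : ∃ x t, 0 < t ∧ φ (x + 2 * t) - 2 * φ (x + t) + φ x ≠ 0 := by
    by_contra! H
    exact hφ (exists_affine_of_second_difference_eq_zero φ.continuous H)
  have hder : ∀ (f : C(ℝ, ℝ)) (x : ℝ),
      HasDerivAt (fun x => ∫ s in x..x + h, f s) (f (x + h) - f x) x := fun f x => by
    have h0 : ∀ y, HasDerivAt (fun y => ∫ s in (0 : ℝ)..y, f s) (f y) y := fun y =>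
      intervalIntegral.integral_hasDerivAt_right (f.continuous.intervalIntegrable _ _)
        f.continuous.stronglyMeasurable.stronglyMeasurableAtFilter f.continuous.continuousAt
    have h1 := ((h0 (x + h)).comp_add_const x h).sub (h0 x)
    refine h1.congr_of_eventuallyEq (Filter.Eventually.of_forall fun y => ?_)
    exact (intervalIntegral.integral_interval_sub_left (f.continuous.intervalIntegrable _ _)
      (f.continuous.intervalIntegrable _ _)).symm
  have havg : ∀ f ∈ F, ∃ ψ ∈ F, ∀ x, HasDerivAt ψ (f (x + h) - f x) x := fun f hf => by
    refine ⟨⟨fun x => ∫ s in x..x + h, f s, continuous_iff_continuousAt.2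
      fun x => (hder f x).continuousAt⟩, ?_, hder f⟩
    refine average_mem_of_translates_mem hF (fun s => ?_) hh fun x => rfl
    convert hsub f hf 1 s using 3
    ext x
    simp
  obtain ⟨ψ, hψF, hψ⟩ := havg φ hφF
  obtain ⟨g, hgF, hg⟩ := havg ψ hψF
  have hdg : deriv g = fun x => ψ (x + h) - ψ x := funext fun x => (hg x).deriv
  have hdg2 : ∀ x, HasDerivAt (deriv g) (φ (x + 2 * h) - 2 * φ (x + h) + φ x) x := fun x => by
    rw [hdg]
    refine (((hψ (x + h)).comp_add_const x h).sub (hψ x)).congr_deriv ?_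
    rw [show x + 2 * h = x + h + h by ring]
    ring
  have hg2 : ContDiff ℝ 2 g := by
    rw [show (2 : WithTop ℕ∞) = 1 + 1 by norm_num, contDiff_succ_iff_deriv]
    refine ⟨fun x => (hg x).differentiableAt, by simp, ?_⟩
    rw [contDiff_one_iff_deriv]
    refine ⟨fun x => (hdg2 x).differentiableAt, ?_⟩
    rw [show deriv (deriv g) = _ from funext fun x => (hdg2 x).deriv]
    fun_prop
  have hne' : deriv (deriv g) x₁ ≠ 0 := by rwa [(hdg2 x₁).deriv]
  have hRc := continuous_secondRemainder (a := x₁) hg2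
  let Φ : C(ℝ, C(ℝ, ℝ)) := ContinuousMap.curry
    ⟨fun p : ℝ × ℝ => p.2 ^ 2 * secondRemainder g x₁ (p.1 * p.2), by fun_prop⟩
  have hq0 : q = Φ 0 := by
    ext u
    simp [Φ, hq, secondRemainder_zero hg2 hne']
  rw [hq0]
  refine hF.mem_of_tendsto
    ((Φ.continuous.tendsto 0).mono_left (nhdsWithin_le_nhds (s := {0}ᶜ))) ?_
  filter_upwards [self_mem_nhdsWithin] with t ht
  have ht' : t ≠ 0 := ht
  have heq : Φ t = (2 / (t ^ 2 * deriv (deriv g) x₁)) •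
      (g.comp ⟨fun x => t * x + x₁, by fun_prop⟩ - g x₁ • ContinuousMap.const ℝ (1 : ℝ)
        - (deriv g x₁ * t) • ContinuousMap.id ℝ) := by
    ext u
    have := sq_mul_secondRemainder hne' (t * u)
    rw [add_comm x₁] at this
    simp only [Φ, ContinuousMap.curry_apply, ContinuousMap.coe_mk, ContinuousMap.smul_apply,
      ContinuousMap.sub_apply, ContinuousMap.comp_apply, ContinuousMap.const_apply,
      ContinuousMap.id_apply, smul_eq_mul, mul_one]
    rw [show g (t * u + x₁) - g x₁ - deriv g x₁ * t * u
      = g (t * u + x₁) - g x₁ - deriv g x₁ * (t * u) by ring, ← this]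
    field_simp
  rw [heq]
  exact F.smul_mem _ (F.sub_mem (F.sub_mem (hsub g hgF _ _) (F.smul_mem _ hone))
    (F.smul_mem _ hid))

/-! ### Universality for general activation functions -/

/-- The line through `0` in direction `v`, as a continuous map. -/
def lineMap {κ : Type} (v : κ → ℝ) : C(ℝ, κ → ℝ) := ⟨fun t => t • v, by fun_prop⟩

section Universality

variable {σ : C(ℝ, ℝ)} {d : ℕ} {κ : Type} [Fintype κ]

/-- The functions `φ` for which the shears `y ↦ y + φ (ℓ y + b) • v` with `ℓ v = 0` can be applied to
the registers. They form a vector space, since shears along the same direction compose by adding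
their profiles. -/
def shearFunctions (σ : C(ℝ, ℝ)) (d : ℕ) (κ : Type) [Fintype κ] : Submodule ℝ C(ℝ, ℝ) where
  carrier := {φ | ∀ f ∈ realizable σ d (κ ⊕ Unit) Set.univ κ,
    ∀ (c : C(EuclideanSpace ℝ (Fin d), ℝ)) (v : κ → ℝ) (ℓ : (κ → ℝ) →ₗ[ℝ] ℝ) (b : ℝ), ℓ v = 0 →
    (∀ x, c x = ℓ (f x) + b) →
    f + (lineMap v).comp (φ.comp c) ∈ realizable σ d (κ ⊕ Unit) Set.univ κ}
  add_mem' := by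
    intro φ₁ φ₂ h₁ h₂ f hf c v ℓ b hv hc
    convert h₂ _ (h₁ f hf c v ℓ b hv hc) c v ℓ b hv (fun x => by simp [lineMap, hv, hc]) using 1
    ext x i
    simp [lineMap]
    ring
  zero_mem' := by
    intro f hf c v ℓ b hv hc
    convert hf using 1
    ext x i
    simp [lineMap]
  smul_mem' := by
    intro a φ h f hf c v ℓ b hv hc
    convert h f hf c (a • v) ℓ b (by simp [hv]) hc using 1
    ext x i
    simp [lineMap]
    ring

theorem isClosed_shearFunctions :
    IsClosed (shearFunctions σ d κ : Set C(ℝ, ℝ)) := by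
  refine isClosed_of_closure_subset fun φ hφ => ?_
  intro f hf c v ℓ b hv hc
  have hcont : Continuous fun φ : C(ℝ, ℝ) => f + (lineMap v).comp (φ.comp c) :=
    continuous_const.add ((lineMap v).continuous_postcomp.comp c.continuous_precomp)
  have := map_mem_closure hcont hφ (t := realizable σ d (κ ⊕ Unit) Set.univ κ)
    (fun ψ hψ => hψ f hf c v ℓ b hv hc)
  rwa [isClosed_realizable.closure_eq] at this

/-- The square is the profile of a realizable shear, because the profiles form a closed invariant
subspace that contains the activation function. -/
theorem sq_mem_shearFunctions {x₀ : ℝ} (hσ : DifferentiableAt ℝ σ x₀) (hσ' : deriv σ x₀ ≠ 0)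
    (hna : ¬ ∃ a b : ℝ, ∀ x, σ x = a * x + b) {q : C(ℝ, ℝ)} (hq : ∀ x, q x = x ^ 2) :
    q ∈ shearFunctions σ d κ := by
  refine sq_mem_of_not_affine isClosed_shearFunctions (φ := σ) ?_ ?_ ?_ ?_ hna hq
  · intro φ hφ a b f hf c v ℓ b' hv hc
    exact hφ f hf ⟨fun x => a * c x + b, by fun_prop⟩ v (a • ℓ) (a * b' + b) (by simp [hv])
      fun x => by simp [hc]; ring
  · intro f hf c v ℓ b hv hc
    refine realizable_affine hf LinearMap.id v fun x => ?_
    simp [lineMap]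
  · intro f hf c v ℓ b hv hc
    refine realizable_affine hf (LinearMap.id + LinearMap.smulRight ℓ v) (b • v) fun x => ?_
    simp [lineMap, hc, add_smul, add_assoc]
  · intro f hf c v ℓ b _ hc
    exact realizable_add_activations hσ hσ' (fun _ _ => Set.mem_univ _) hf (fun _ => ℓ)
      (fun _ => b) (fun _ => v) LinearMap.id 0 fun x => by simp [lineMap, hc]

end Universality

section Addable

variable {σ : C(ℝ, ℝ)} {d : ℕ} {μ : Type} [Fintype μ] [DecidableEq μ]

/-- `g` can be added to any of the registers `μ`, whatever the contents of these registers, provided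
that the input is kept in the registers `Fin d` and that there is a second register in `μ`. -/
def IsAddable (σ : C(ℝ, ℝ)) (d : ℕ) (μ : Type) [Fintype μ] [DecidableEq μ]
    (g : C(EuclideanSpace ℝ (Fin d), ℝ)) : Prop :=
  ∀ A B : μ, A ≠ B → ∀ c : ℝ,
    ∀ f ∈ realizable σ d ((Fin d ⊕ μ) ⊕ Unit) Set.univ (Fin d ⊕ μ),
    (∀ x i, f x (Sum.inl i) = x i) →
    f + (lineMap (Pi.single (Sum.inr A) c)).comp g ∈
      realizable σ d ((Fin d ⊕ μ) ⊕ Unit) Set.univ (Fin d ⊕ μ)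

theorem IsAddable.add {g₁ g₂ : C(EuclideanSpace ℝ (Fin d), ℝ)} (h₁ : IsAddable σ d μ g₁)
    (h₂ : IsAddable σ d μ g₂) : IsAddable σ d μ (g₁ + g₂) := by
  intro A B hAB c f hf hx
  convert h₂ A B hAB c _ (h₁ A B hAB c f hf hx) (fun x i => by simp [lineMap, hx]) using 1
  ext x i
  simp [lineMap]
  ring

theorem IsAddable.smul {g : C(EuclideanSpace ℝ (Fin d), ℝ)} (h : IsAddable σ d μ g) (a : ℝ) :
    IsAddable σ d μ (a • g) := by
  intro A B hAB c f hf hx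
  convert h A B hAB (a * c) f hf hx using 1
  ext x i
  by_cases hi : i = Sum.inr A
  · subst hi
    simp [lineMap]
    ring
  · simp [lineMap, hi]

theorem isAddable_affine {g : C(EuclideanSpace ℝ (Fin d), ℝ)}
    (ℓ : (Fin d → ℝ) →ₗ[ℝ] ℝ) (b : ℝ) (hg : ∀ x : EuclideanSpace ℝ (Fin d), g x = ℓ x + b) :
    IsAddable σ d μ g := by
  intro A B hAB c f hf hx
  refine realizable_affine hf
    (LinearMap.id + LinearMap.smulRight (ℓ ∘ₗ LinearMap.funLeft ℝ ℝ Sum.inl)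
      (Pi.single (Sum.inr A) c)) (b • Pi.single (Sum.inr A) c) fun x => ?_
  have : LinearMap.funLeft ℝ ℝ Sum.inl (f x) = (x : Fin d → ℝ) := funext fun i => hx x i
  simp [lineMap, hg, this, add_smul, add_assoc]

/-- The identity `(b + g)² + (b - g)² - 2 b² = 2 g²` shows how to add a square to one register with
the help of another one whose content `b` is unknown and is restored at the end. -/
theorem IsAddable.sq {x₀ : ℝ} (hσ : DifferentiableAt ℝ σ x₀) (hσ' : deriv σ x₀ ≠ 0)
    (hna : ¬ ∃ a b : ℝ, ∀ x, σ x = a * x + b) {g : C(EuclideanSpace ℝ (Fin d), ℝ)}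
    (h : IsAddable σ d μ g) : IsAddable σ d μ (g * g) := by
  intro A B hAB c f hf hx
  have hadd : ∀ (a : ℝ) (f : C(EuclideanSpace ℝ (Fin d), Fin d ⊕ μ → ℝ)),
      f ∈ realizable σ d ((Fin d ⊕ μ) ⊕ Unit) Set.univ (Fin d ⊕ μ) →
      (∀ x i, f x (Sum.inl i) = x i) →
      ∃ f' ∈ realizable σ d ((Fin d ⊕ μ) ⊕ Unit) Set.univ (Fin d ⊕ μ),
      (∀ x i, f' x (Sum.inl i) = x i) ∧
      ∀ x i, f' x (Sum.inr i) = f x (Sum.inr i) + if i = B then a * g x else 0 := by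
    intro a f hf hx
    refine ⟨_, h B A hAB.symm a f hf hx, fun x i => by simp [lineMap, hx], fun x i => ?_⟩
    by_cases hi : i = B
    · subst hi
      simp [lineMap]
      ring
    · simp [lineMap, hi]
  have hsq : ∀ (a : ℝ) (f : C(EuclideanSpace ℝ (Fin d), Fin d ⊕ μ → ℝ)),
      f ∈ realizable σ d ((Fin d ⊕ μ) ⊕ Unit) Set.univ (Fin d ⊕ μ) →
      (∀ x i, f x (Sum.inl i) = x i) →
      ∃ f' ∈ realizable σ d ((Fin d ⊕ μ) ⊕ Unit) Set.univ (Fin d ⊕ μ),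
      (∀ x i, f' x (Sum.inl i) = x i) ∧
      ∀ x i, f' x (Sum.inr i) =
        f x (Sum.inr i) + if i = A then a * f x (Sum.inr B) ^ 2 else 0 := by
    intro a f hf hx
    have hq : (⟨fun x => x ^ 2, by fun_prop⟩ : C(ℝ, ℝ)) ∈ shearFunctions σ d (Fin d ⊕ μ) :=
      sq_mem_shearFunctions hσ hσ' hna fun x => rfl
    refine ⟨_, hq f hf ⟨fun x => f x (Sum.inr B), by fun_prop⟩ (Pi.single (Sum.inr A) a)
      (LinearMap.proj (Sum.inr B)) 0 (by simp [hAB.symm]) (fun x => by simp),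
      fun x i => by simp [lineMap, hx], fun x i => ?_⟩
    by_cases hi : i = A
    · subst hi
      simp [lineMap]
      ring
    · simp [lineMap, hi]
  obtain ⟨f₁, m₁, x₁, v₁⟩ := hadd 1 f hf hx
  obtain ⟨f₂, m₂, x₂, v₂⟩ := hsq (c / 2) f₁ m₁ x₁
  obtain ⟨f₃, m₃, x₃, v₃⟩ := hadd (-2) f₂ m₂ x₂
  obtain ⟨f₄, m₄, x₄, v₄⟩ := hsq (c / 2) f₃ m₃ x₃
  obtain ⟨f₅, m₅, x₅, v₅⟩ := hadd 1 f₄ m₄ x₄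
  obtain ⟨f₆, m₆, x₆, v₆⟩ := hsq (-c) f₅ m₅ x₅
  convert m₆ using 1
  ext x i
  rcases i with i | i
  · simp [lineMap, hx, x₆]
  · have hBA := hAB.symm
    simp only [v₆, v₅, v₄, v₃, v₂, v₁]
    by_cases hi : i = A
    · subst hi
      simp [lineMap, hAB, hBA]
      ring
    · by_cases hi' : i = B
      · subst hi'
        simp [lineMap, hi]
        ring
      · simp [lineMap, hi, hi']

/-- The addable functions form an algebra; products are obtained from squares by polarization. -/
def addableSubalgebra {σ : C(ℝ, ℝ)} {x₀ : ℝ} (hσ : DifferentiableAt ℝ σ x₀)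
    (hσ' : deriv σ x₀ ≠ 0) (hna : ¬ ∃ a b : ℝ, ∀ x, σ x = a * x + b) (d : ℕ) (μ : Type)
    [Fintype μ] [DecidableEq μ] : Subalgebra ℝ C(EuclideanSpace ℝ (Fin d), ℝ) where
  carrier := {g | IsAddable σ d μ g}
  add_mem' := fun h₁ h₂ => IsAddable.add h₁ h₂
  algebraMap_mem' := fun r => isAddable_affine 0 r fun x => by simp
  mul_mem' := by
    intro g₁ g₂ h₁ h₂
    have h3 := ((h₁.add h₂).sq hσ hσ' hna).smul (1 / 4)
    have h4 := ((h₁.add (h₂.smul (-1))).sq hσ hσ' hna).smul (-1 / 4)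
    change IsAddable σ d μ _
    convert h3.add h4 using 1
    ext x
    simp
    ring

end Addable

/-- On a compact set, every tuple of continuous functions is a uniform limit of networks of width
`d + N + 2`. Besides the registers for the input and for the outputs there is one scratch register
`none`, and one neuron is needed to apply the activation function. -/
theorem exists_realizable_near {σ : C(ℝ, ℝ)} {x₀ : ℝ} (hσ : DifferentiableAt ℝ σ x₀)
    (hσ' : deriv σ x₀ ≠ 0) (hna : ¬ ∃ a b : ℝ, ∀ x, σ x = a * x + b) {d N : ℕ}
    {X : Set (EuclideanSpace ℝ (Fin d))} (hX : IsCompact X)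
    (h : Fin N → C(EuclideanSpace ℝ (Fin d), ℝ)) {ε : ℝ} (hε : 0 < ε) :
    ∃ f ∈ realizable σ d ((Fin d ⊕ Option (Fin N)) ⊕ Unit) Set.univ (Fin N),
      ∀ n, ∀ x ∈ X, |f x n - h n x| < ε := by
  let 𝓐 := addableSubalgebra hσ hσ' hna d (Option (Fin N))
  have hsep : 𝓐.SeparatesPoints := by
    intro x y hxy
    obtain ⟨i, hi⟩ : ∃ i, x i ≠ y i := by
      by_contra! H
      exact hxy (PiLp.ext H)
    refine ⟨_, ⟨⟨fun z => z i, by fun_prop⟩, ?_, rfl⟩, hi⟩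
    exact isAddable_affine (LinearMap.proj i) 0 fun z => by simp
  choose g hg hgh using fun n =>
    ContinuousMap.exists_mem_subalgebra_near_continuous_of_isCompact_of_separatesPoints
      hsep (h n) hX hε
  have key : ∀ s : Finset (Fin N),
      ∃ f ∈ realizable σ d ((Fin d ⊕ Option (Fin N)) ⊕ Unit) Set.univ (Fin d ⊕ Option (Fin N)),
      (∀ x i, f x (Sum.inl i) = x i) ∧
      ∀ x n, f x (Sum.inr (some n)) = if n ∈ s then g n x else 0 := by
    intro s
    induction s using Finset.induction_on with
    | empty =>
      let L : EuclideanSpace ℝ (Fin d) →ₗ[ℝ] (Fin d ⊕ Option (Fin N) → ℝ) :=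
        LinearMap.pi (Sum.elim (fun i => LinearMap.proj i ∘ₗ
          (WithLp.linearEquiv 2 ℝ (Fin d → ℝ)).toLinearMap) 0)
      refine ⟨⟨L, L.continuous_of_finiteDimensional⟩,
        affine_mem_realizable (Set.mem_univ 0) L 0 (fun x => by simp), ?_, ?_⟩
      · intro x i; rfl
      · intro x n; rfl
    | insert a s has ih =>
      obtain ⟨f, hf, hx, hv⟩ := ih
      refine ⟨_, hg a (some a) none (by simp) 1 f hf hx, fun x i => by simp [lineMap, hx],
        fun x n => ?_⟩
      by_cases hn : n = a
      · subst hn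
        simp [lineMap, hv, has]
      · simp [lineMap, hv, hn]
  obtain ⟨f, hf, -, hv⟩ := key Finset.univ
  refine ⟨⟨fun x n => f x (Sum.inr (some n)), by fun_prop⟩,
    realizable_affine hf (LinearMap.funLeft ℝ ℝ fun n => Sum.inr (some n)) 0 (fun x => by
      simp; rfl), fun n x hx => ?_⟩
  have := hgh n x hx
  simpa [hv] using this

/-- Compact sets are approximated by deep zero-sets of networks of width `d + N + 2` with an
arbitrary regular activation function. -/
theorem exists_approximatesSets_of_regular {d N : ℕ} {σ : ℝ → ℝ} (hσ : IsRegularActivation σ)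
    {X : Set (EuclideanSpace ℝ (Fin d))} (hX : IsCompact X)
    {K : Fin N → Set (EuclideanSpace ℝ (Fin d))}
    (hK : ∀ n, (K n).Nonempty ∧ IsCompact (K n) ∧ K n ⊆ X) {ε : ℝ} (hε : 0 < ε) {γ : ℝ}
    (hγ : γ ∈ Set.Ioo (0 : ℝ) 1) :
    ∃ c : FFNN N d, c.width ≤ d + N + 2 ∧ c.ApproximatesSets σ X γ K ε := by
  obtain ⟨hc, hna, x₀, hd, -, hd0⟩ := hσ
  obtain ⟨f, hf, hfh⟩ := exists_realizable_near (σ := ⟨σ, hc⟩) hd.self_of_nhds hd0 hna hX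
    (fun n : Fin N => ⟨fun x => ε / 2 - Metric.infDist x (K n), by fun_prop⟩) (half_pos hε)
  have e : (Fin d ⊕ Option (Fin N)) ⊕ Unit ↪ Fin (d + N + 2) :=
    (Fintype.equivFinOfCardEq (by simp; ring)).toEmbedding
  obtain ⟨c, h1, -, h3⟩ := exists_approximatesSets e hf hX (fun n => (hK n).1) (P := K) (ε := ε) hγ
    (fun n => (hK n).2.1) (fun n => (hK n).2.2)
    (fun n x hx => ⟨x, hx, by simp [hε.le]⟩)
    (fun n x hx => by
      have := abs_lt.1 (hfh n x ((hK n).2.2 hx))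
      simp only [ContinuousMap.coe_mk, Metric.infDist_zero_of_mem hx] at this
      linarith)
    (fun n x hx hxK => by
      have := abs_lt.1 (hfh n x hx)
      simp only [ContinuousMap.coe_mk] at this
      linarith)
  exact ⟨c, c.width_le_of_hasConstantWidth h1, h3⟩

/-! ### Labelled grids in the unit cube -/

/-- The point of the grid with spacing `1 / R` in the unit cube with index `i`. -/
noncomputable def gridPoint {d R : ℕ} (i : Fin d → Fin (R + 1)) : EuclideanSpace ℝ (Fin d) :=
  WithLp.toLp 2 fun k => (i k : ℝ) / R

/-- The labels of the grid points: a marked grid point gets as label one more than the residue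
modulo `N + 1` of its index in the direction `k₀`, and the other grid points get the label `0`. Hence
a grid point can only be used for one of the sets `K₁, …, K_N`. -/
noncomputable def gridLabel {d R : ℕ} (N : ℕ) (k₀ : Fin d) (mark : (Fin d → Fin (R + 1)) → Prop)
    (i : Fin d → Fin (R + 1)) : ℕ :=
  open Classical in if mark i then (i k₀ : ℕ) % (N + 1) + 1 else 0

theorem isCompact_unitCube (d : ℕ) : IsCompact (unitCube d) := by
  have h : unitCube d = (EuclideanSpace.equiv (Fin d) ℝ).toHomeomorph ⁻¹'
      (Set.univ.pi fun _ => Set.Icc (0 : ℝ) 1) := by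
    ext x
    simp only [unitCube, Set.mem_ofPred_eq, Set.mem_preimage, Set.mem_univ_pi]
    rfl
  rw [h, Homeomorph.isCompact_preimage]
  exact isCompact_univ_pi fun _ => isCompact_Icc

theorem gridPoint_mem_unitCube {d R : ℕ} (i : Fin d → Fin (R + 1)) :
    gridPoint i ∈ unitCube d := fun k => by
  have h : ((i k : ℕ) : ℝ) ≤ R := by exact_mod_cast Nat.lt_succ_iff.1 (i k).2
  exact ⟨by simp only [gridPoint]; positivity, div_le_one_of_le₀ h (Nat.cast_nonneg _)⟩

theorem dist_le_of_forall_coord {d : ℕ} {x y : EuclideanSpace ℝ (Fin d)} {c : ℝ} (hc : 0 ≤ c)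
    (h : ∀ k, |x k - y k| ≤ c) : dist x y ≤ d * c := by
  rw [EuclideanSpace.dist_eq]
  refine Real.sqrt_le_iff.2 ⟨by positivity, ?_⟩
  calc ∑ k, dist (x k) (y k) ^ 2 ≤ ∑ _k : Fin d, c ^ 2 := by
        refine Finset.sum_le_sum fun k _ => ?_
        rw [Real.dist_eq]
        exact pow_le_pow_left₀ (abs_nonneg _) (h k) 2
    _ = d * c ^ 2 := by simp
    _ ≤ (d : ℝ) ^ 2 * c ^ 2 := by
        gcongr
        rcases Nat.eq_zero_or_pos d with rfl | hd
        · simp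
        · have : (1 : ℝ) ≤ d := by exact_mod_cast hd
          nlinarith
    _ = (d * c) ^ 2 := by ring

/-- Near each number in `[0, R]` there is an integer in `[0, R]` with given residue modulo `N + 1`. -/
theorem exists_near_with_residue {N R : ℕ} (hR : N + 1 ≤ R) {y : ℝ} (hy0 : 0 ≤ y) (hyR : y ≤ R)
    {n : ℕ} (hn : n < N + 1) :
    ∃ j : Fin (R + 1), (j : ℕ) % (N + 1) = n ∧ |y - j| ≤ N + 1 := by
  set m := ⌊y⌋₊ with hm
  have h1 : (m : ℝ) ≤ y := Nat.floor_le hy0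
  have h2 : y < m + 1 := Nat.lt_floor_add_one y
  have h3 := Nat.div_add_mod m (N + 1)
  have h4 : m % (N + 1) < N + 1 := Nat.mod_lt m (Nat.succ_pos N)
  set a := (N + 1) * (m / (N + 1)) with ha
  have hmod : ∀ q, ((N + 1) * q + n) % (N + 1) = n := fun q => by
    rw [Nat.mul_add_mod, Nat.mod_eq_of_lt hn]
  by_cases hle : a + n ≤ R
  · refine ⟨⟨a + n, by omega⟩, hmod _, ?_⟩
    have h5 : ((a + n : ℕ) : ℝ) ≤ m + N := by exact_mod_cast (by omega : a + n ≤ m + N)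
    have h6 : (m : ℝ) ≤ ((a + n : ℕ) : ℝ) + N := by exact_mod_cast (by omega : m ≤ a + n + N)
    rw [abs_le]
    constructor <;> simp only <;> linarith
  · have hq : 1 ≤ m / (N + 1) := by
      by_contra! hq
      have h0 : m / (N + 1) = 0 := Nat.lt_one_iff.1 hq
      rw [h0, mul_zero] at ha
      omega
    obtain ⟨q, hq⟩ := Nat.exists_eq_add_of_le' hq
    have haq : a = (N + 1) * q + (N + 1) := by rw [ha, hq]; ring
    have hmR : m ≤ R := by exact_mod_cast h1.trans hyR
    refine ⟨⟨(N + 1) * q + n, by omega⟩, hmod _, ?_⟩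
    have h5 : (((N + 1) * q + n : ℕ) : ℝ) ≤ m := by
      exact_mod_cast (by omega : (N + 1) * q + n ≤ m)
    have h6 : (R : ℝ) ≤ (((N + 1) * q + n : ℕ) : ℝ) + (N + 1) := by
      exact_mod_cast (by omega : R ≤ (N + 1) * q + n + (N + 1))
    rw [abs_le]
    constructor <;> simp only <;> linarith

theorem exists_gridPoint_near {d N R : ℕ} (hR : N + 1 ≤ R) (k₀ : Fin d)
    {x : EuclideanSpace ℝ (Fin d)} (hx : x ∈ unitCube d) {n : ℕ} (hn : n < N + 1) :
    ∃ i : Fin d → Fin (R + 1), (i k₀ : ℕ) % (N + 1) = n ∧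
      dist x (gridPoint i) ≤ d * ((N + 1) / R) := by
  have hR0 : (0 : ℝ) < R := by exact_mod_cast (by omega : 0 < R)
  choose j hj1 hj2 using fun k => exists_near_with_residue hR (y := R * x k)
    (mul_nonneg hR0.le (hx k).1) (by nlinarith [(hx k).2]) hn
  refine ⟨j, hj1 k₀, dist_le_of_forall_coord (by positivity) fun k => ?_⟩
  have h : x k - gridPoint j k = (R * x k - j k) / R := by
    simp only [gridPoint]
    field_simp
  rw [h, abs_div, abs_of_pos hR0]
  gcongr
  exact hj2 k

/-- If `h` is negative at the zeros of `G ≥ 0` in a compact set `D`, then a large multiple of `G` as a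
penalty makes `h` negative on all of `D`. -/
theorem exists_penalty {E : Type*} [TopologicalSpace E] {D : Set E} (hD : IsCompact D)
    {G h : C(E, ℝ)} (hG : ∀ x ∈ D, 0 ≤ G x) (hh : ∀ x ∈ D, G x = 0 → h x < 0) :
    ∃ Λ₀ : ℝ, ∀ Λ ≥ Λ₀, ∀ x ∈ D, h x - Λ * G x < 0 := by
  have hD' : IsCompact (D ∩ {x | 0 ≤ h x}) :=
    hD.inter_right (isClosed_le continuous_const h.continuous)
  have hpos : ∀ x ∈ D ∩ {x | 0 ≤ h x}, 0 < G x := fun x hx =>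
    lt_of_le_of_ne (hG x hx.1) fun h0 => absurd (hh x hx.1 h0.symm) (not_lt.2 hx.2)
  obtain ⟨M, hM⟩ := (hD.image h.continuous).bddAbove
  have hM' : ∀ x ∈ D, h x ≤ M := fun x hx => hM ⟨x, hx, rfl⟩
  rcases (D ∩ {x | 0 ≤ h x}).eq_empty_or_nonempty with hemp | hne
  · refine ⟨0, fun Λ hΛ x hx => ?_⟩
    have h1 : h x < 0 := by
      by_contra! h0
      have : x ∈ D ∩ {x | 0 ≤ h x} := ⟨hx, h0⟩
      simp [hemp] at this
    have := mul_nonneg hΛ (hG x hx)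
    linarith
  · obtain ⟨z, hz, hmin⟩ := hD'.exists_isMinOn hne G.continuous.continuousOn
    have hz0 := hpos z hz
    refine ⟨(|M| + 1) / G z, fun Λ hΛ x hx => ?_⟩
    have hΛ0 : 0 ≤ Λ := le_trans (by positivity) hΛ
    by_cases h0 : 0 ≤ h x
    · have h1 : G z ≤ G x := hmin ⟨hx, h0⟩
      have h2 : |M| + 1 ≤ Λ * G z := (div_le_iff₀ hz0).1 hΛ
      have h3 : Λ * G z ≤ Λ * G x := mul_le_mul_of_nonneg_left h1 hΛ0
      linarith [hM' x hx, le_abs_self M]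
    · have := mul_nonneg hΛ0 (hG x hx)
      linarith

/-- Reduction of the approximation problem to interpolation at grid points. Given any set of marked
grid points, it suffices to realize two registers `s` and `q + Λ G`, where `G` vanishes exactly at
the grid points and `s`, `q` interpolate the label and its square. The point `(s, s²)` lies on a
parabola, so that each label can be cut out by an affine function, namely
`2 (n + 1) s - s² - (n + 1)² + 1 / 2 = 1 / 2 - (s - (n + 1))²`. -/
theorem exists_approximatesSets_of_grid {d N R T w : ℕ} {σ : C(ℝ, ℝ)} {ι : Type} [Fintype ι]
    (e : ι ↪ Fin w) (k₀ : Fin d) {ε : ℝ} (hε : 0 < ε) (hNR : N + 1 ≤ R)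
    (hR : 2 * (d * ((N + 1) / R : ℝ)) ≤ ε)
    (hreal : ∀ mark : (Fin d → Fin (R + 1)) → Prop,
      ∃ G s q : C(EuclideanSpace ℝ (Fin d), ℝ), (∀ x, 0 ≤ G x) ∧
        (∀ x ∈ unitCube d, G x = 0 → ∃ i : Fin d → Fin (R + 1), x = gridPoint i) ∧
        (∀ i : Fin d → Fin (R + 1), G (gridPoint i) = 0 ∧
          s (gridPoint i) = gridLabel N k₀ mark i ∧
          q (gridPoint i) = (gridLabel N k₀ mark i : ℝ) ^ 2) ∧
        ∀ Λ : ℝ, ∃ f ∈ realizable σ d ι {T} (Fin 2),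
          ∀ x, f x 0 = s x ∧ f x 1 = q x + Λ * G x)
    {K : Fin N → Set (EuclideanSpace ℝ (Fin d))}
    (hK : ∀ n, (K n).Nonempty ∧ IsCompact (K n) ∧ K n ⊆ unitCube d)
    {γ : ℝ} (hγ : γ ∈ Set.Ioo (0 : ℝ) 1) :
    ∃ c : FFNN N d, c.HasConstantWidth w ∧ c.depth = T + 1 ∧
      c.ApproximatesSets σ (unitCube d) γ K ε := by
  let mark : (Fin d → Fin (R + 1)) → Prop := fun i =>
    ∃ n : Fin N, (i k₀ : ℕ) % (N + 1) = n ∧ Metric.infDist (gridPoint i) (K n) < ε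
  have hlabel : ∀ (i) (n : Fin N), gridLabel N k₀ mark i = n + 1 ↔
      (i k₀ : ℕ) % (N + 1) = n ∧ Metric.infDist (gridPoint i) (K n) < ε := by
    intro i n
    unfold gridLabel
    constructor
    · intro h
      split_ifs at h with hm
      · obtain ⟨n', h1, h2⟩ := hm
        have : n' = n := Fin.ext (by omega)
        exact this ▸ ⟨h1, h2⟩
    · intro h
      rw [if_pos ⟨n, h⟩, h.1]
  obtain ⟨G, s, q, hG0, hGgrid, hgrid, hf⟩ := hreal mark
  let h : Fin N → C(EuclideanSpace ℝ (Fin d), ℝ) := fun n =>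
    ⟨fun x => 2 * (n + 1) * s x - q x - (n + 1) ^ 2 + 1 / 2, by fun_prop⟩
  have hval : ∀ n i, h n (gridPoint i) =
      1 / 2 - ((gridLabel N k₀ mark i : ℝ) - (n + 1)) ^ 2 := fun n i => by
    simp only [h, ContinuousMap.coe_mk, (hgrid i).2.1, (hgrid i).2.2]
    ring
  have hpen : ∀ n, ∃ Λ₀ : ℝ, ∀ Λ ≥ Λ₀,
      ∀ x ∈ unitCube d ∩ {x | ε ≤ Metric.infDist x (K n)}, h n x - Λ * G x < 0 := fun n => by
    refine exists_penalty ((isCompact_unitCube d).inter_right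
      (isClosed_le continuous_const (Metric.continuous_infDist_pt _)))
      (fun x _ => hG0 x) fun x hx hGx => ?_
    obtain ⟨i, rfl⟩ := hGgrid x hx.1 hGx
    have hne : gridLabel N k₀ mark i ≠ n + 1 := fun hl =>
      absurd ((hlabel i n).1 hl).2 (not_lt.2 hx.2)
    have h1 : (1 : ℤ) ≤ |(gridLabel N k₀ mark i : ℤ) - (n + 1)| :=
      Int.one_le_abs (sub_ne_zero.2 (by exact_mod_cast hne))
    have h2 : (1 : ℝ) ≤ |(gridLabel N k₀ mark i : ℝ) - (n + 1)| := by exact_mod_cast h1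
    rw [hval, ← sq_abs]
    nlinarith
  choose Λ₀ hΛ₀ using hpen
  obtain ⟨Λ, hΛ⟩ := (Set.finite_range Λ₀).bddAbove
  obtain ⟨f, hfr, hfx⟩ := hf Λ
  have hf' := realizable_affine (κ' := Fin N) hfr
    (LinearMap.pi fun n : Fin N =>
      (2 * ((n : ℝ) + 1)) • LinearMap.proj (0 : Fin 2) - LinearMap.proj (1 : Fin 2))
    (fun n => - ((n : ℝ) + 1) ^ 2 + 1 / 2)
    (g := ⟨fun x n => h n x - Λ * G x, by fun_prop⟩) (fun x => by
      funext n
      simp [h, hfx]; ring)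
  obtain ⟨c, h1, ⟨T', hT', h2⟩, h3⟩ := exists_approximatesSets e (S := {T})
    hf' (isCompact_unitCube d) (fun n => (hK n).1) (ε := ε) hγ
    (P := fun n => Set.range fun i : {i // gridLabel N k₀ mark i = n + 1} => gridPoint i.1)
    (fun n => (Set.finite_range _).isCompact)
    (fun n => Set.range_subset_iff.2 fun i => gridPoint_mem_unitCube _)
    (fun n x hx => by
      obtain ⟨i, hi, hxi⟩ := exists_gridPoint_near hNR k₀ ((hK n).2.2 hx) (n := n) (by omega)
      have hlt : dist x (gridPoint i) < ε := by
        have := dist_nonneg.trans hxi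
        linarith
      refine ⟨_, ⟨⟨i, (hlabel i n).2 ⟨hi, ?_⟩⟩, rfl⟩, hlt.le⟩
      exact (Metric.infDist_le_dist_of_mem hx).trans_lt (by rwa [dist_comm]))
    (fun n x hx => by
      obtain ⟨⟨i, hi⟩, rfl⟩ := hx
      change 0 < h n (gridPoint i) - Λ * G (gridPoint i)
      rw [hval, (hgrid i).1, hi]
      norm_num)
    (fun n x hx hxK => hΛ₀ n Λ (hΛ ⟨n, rfl⟩) x ⟨hx, hxK⟩)
  rw [Set.mem_singleton_iff.1 hT'] at h2
  exact ⟨c, h1, h2, h3⟩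

/-! ### ReLU networks: hat functions and bit extraction -/

/-- The rectified linear unit. -/
def relu : C(ℝ, ℝ) := ⟨fun x => max 0 x, by fun_prop⟩

/-- The hat function `u ↦ max 0 (1 - |u|)`, as a combination of rectified linear units. -/
noncomputable def hat (u : ℝ) : ℝ := relu (u + 1) - 2 * relu u + relu (u - 1)

theorem hat_eq (u : ℝ) : hat u = max 0 (1 - |u|) := by
  simp only [hat, relu, ContinuousMap.coe_mk]
  rcases le_total u 0 with h | h
  · rw [abs_of_nonpos h, max_eq_left h, max_eq_left (by linarith : u - 1 ≤ 0), sub_neg_eq_add,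
      add_comm 1 u]
    ring
  · rw [abs_of_nonneg h, max_eq_right h, max_eq_right (by linarith : 0 ≤ u + 1)]
    rcases le_total u 1 with h1 | h1
    · rw [max_eq_left (by linarith : u - 1 ≤ 0), max_eq_right (by linarith : 0 ≤ 1 - u)]
      ring
    · rw [max_eq_right (by linarith : 0 ≤ u - 1), max_eq_left (by linarith : 1 - u ≤ 0)]
      ring

theorem hat_nonneg (u : ℝ) : 0 ≤ hat u := by rw [hat_eq]; exact le_max_left _ _

theorem hat_pos {u : ℝ} (h : |u| < 1) : 0 < hat u := by
  rw [hat_eq]; exact lt_max_of_lt_right (by linarith)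

theorem hat_eq_zero {u : ℝ} (h : 1 ≤ |u|) : hat u = 0 := by
  rw [hat_eq]; exact max_eq_left (by linarith)

theorem hat_intCast (z : ℤ) : hat z = if z = 0 then 1 else 0 := by
  split_ifs with h
  · simp [hat_eq, h]
  · exact hat_eq_zero (by exact_mod_cast Int.one_le_abs h)

@[fun_prop]
theorem continuous_hat : Continuous hat := by
  unfold hat
  fun_prop

theorem hasDerivAt_relu_one : HasDerivAt relu 1 1 := by
  refine (hasDerivAt_id (1 : ℝ)).congr_of_eventuallyEq ?_
  filter_upwards [lt_mem_nhds (zero_lt_one (α := ℝ))] with x hx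
  exact max_eq_right hx.le

/-- The registers of the ReLU network besides those for the input. They hold the penalty that
vanishes on the grid, the binary code of a column of the grid, the label, its square, and an
intermediate result of the decoding. -/
inductive ReluReg
  | pen | code | lab | labSq | tmp
  deriving DecidableEq

instance : Fintype ReluReg where
  elems := {.pen, .code, .lab, .labSq, .tmp}
  complete r := by cases r <;> decide

section Relu

variable {d : ℕ}

open ReluReg

/-- The maps that are realized by `T` layers with five neurons besides the registers. -/
abbrev reluRealizable (d T : ℕ) : Set C(EuclideanSpace ℝ (Fin d), Fin d ⊕ ReluReg → ℝ) :=
  realizable relu d ((Fin d ⊕ ReluReg) ⊕ Fin 5) {T} (Fin d ⊕ ReluReg)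

theorem reluRealizable_step {T : ℕ} {f : C(EuclideanSpace ℝ (Fin d), Fin d ⊕ ReluReg → ℝ)}
    (hf : f ∈ reluRealizable d T) (ℓ : Fin 5 → (Fin d ⊕ ReluReg → ℝ) →ₗ[ℝ] ℝ) (β : Fin 5 → ℝ)
    (v : Fin 5 → Fin d ⊕ ReluReg → ℝ)
    (L : (Fin d ⊕ ReluReg → ℝ) →ₗ[ℝ] (Fin d ⊕ ReluReg → ℝ)) (b : Fin d ⊕ ReluReg → ℝ)
    {g : C(EuclideanSpace ℝ (Fin d), Fin d ⊕ ReluReg → ℝ)}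
    (hg : ∀ x, g x = L (f x) + b + ∑ m, relu (ℓ m (f x) + β m) • v m) :
    g ∈ reluRealizable d (T + 1) :=
  realizable_add_activations hasDerivAt_relu_one.differentiableAt
    (by rw [hasDerivAt_relu_one.deriv]; exact one_ne_zero) (by simp) hf ℓ β v L b hg

/-- A sum of `n` hat functions of affine functions of the input can be added to a register by `n`
layers. -/
theorem reluRealizable_add_hats {α : Type} [DecidableEq α] (r : ReluReg)
    (ℓ : α → (Fin d → ℝ) →ₗ[ℝ] ℝ) (c β : α → ℝ) (s : Finset α) :
    ∀ {T : ℕ} {f : C(EuclideanSpace ℝ (Fin d), Fin d ⊕ ReluReg → ℝ)}, f ∈ reluRealizable d T →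
    (∀ x i, f x (Sum.inl i) = x i) →
    ∃ g ∈ reluRealizable d (T + s.card), (∀ x i, g x (Sum.inl i) = x i) ∧
      (∀ r' ≠ r, ∀ x, g x (Sum.inr r') = f x (Sum.inr r')) ∧
      ∀ x, g x (Sum.inr r) = f x (Sum.inr r) + ∑ i ∈ s, c i * hat (ℓ i x - β i) := by
  induction s using Finset.induction_on with
  | empty => exact fun {T f} hf hx => ⟨f, hf, hx, fun _ _ _ => rfl, fun x => by simp⟩
  | insert a s has ih =>
    intro T f hf hx
    obtain ⟨g, hg, hgx, hgr', hgr⟩ := ih hf hx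
    have hℓc : Continuous fun x : EuclideanSpace ℝ (Fin d) => ℓ a x :=
      (ℓ a).continuous_on_pi.comp (by fun_prop)
    let ℓ' : (Fin d ⊕ ReluReg → ℝ) →ₗ[ℝ] ℝ := ℓ a ∘ₗ LinearMap.funLeft ℝ ℝ Sum.inl
    have hℓ' : ∀ x, ℓ' (g x) = ℓ a x := fun x => by
      simp only [ℓ', LinearMap.comp_apply]
      congr 1
      funext i
      exact hgx x i
    refine ⟨g + (lineMap (Pi.single (Sum.inr r) 1)).comp
      ⟨fun x : EuclideanSpace ℝ (Fin d) => c a * hat (ℓ a x - β a), by fun_prop⟩, ?_, ?_, ?_, ?_⟩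
    · rw [Finset.card_insert_of_notMem has, ← add_assoc]
      refine reluRealizable_step hg (fun _ => ℓ') ![1 - β a, - β a, -1 - β a, 0, 0]
        ![Pi.single (Sum.inr r) (c a), Pi.single (Sum.inr r) (-2 * c a),
          Pi.single (Sum.inr r) (c a), 0, 0] LinearMap.id 0 fun x => ?_
      funext i
      by_cases hi : i = Sum.inr r
      · subst hi
        simp [Fin.sum_univ_five, hℓ', hat, lineMap]
        ring_nf
      · simp [Fin.sum_univ_five, hi, lineMap]
    · intro x i
      simp [hgx, lineMap]
    · intro r' hr' x
      simp [hgr' r' hr', hr', lineMap]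
    · intro x
      rw [Finset.sum_insert has]
      simp [hgr, lineMap]
      ring

/-- Decoding one bit: if the code is `< 2 ^ (n + 1)`, then its leading bit is removed by two
layers, and a weight is added to the label (and its square to the squared label) if the bit is `1`
and the coordinate `k₀` of the input is the `n`-th one of the grid. -/
theorem reluRealizable_decode_bit (k₀ : Fin d) (R n : ℕ) (w : ℝ) {T : ℕ}
    {f : C(EuclideanSpace ℝ (Fin d), Fin d ⊕ ReluReg → ℝ)} (hf : f ∈ reluRealizable d T)
    (hx : ∀ x i, f x (Sum.inl i) = x i) :
    ∃ g ∈ reluRealizable d (T + 2), (∀ x i, g x (Sum.inl i) = x i) ∧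
      (∀ x, g x (Sum.inr pen) = f x (Sum.inr pen)) ∧
      ∀ x, ∀ (a b J : ℕ), a < 2 ^ n → b ≤ 1 → f x (Sum.inr code) = ((a + b * 2 ^ n : ℕ) : ℝ) →
        R * x k₀ = J →
        g x (Sum.inr code) = a ∧
        g x (Sum.inr lab) = f x (Sum.inr lab) + (if J = n then b * w else 0) ∧
        g x (Sum.inr labSq) = f x (Sum.inr labSq) + (if J = n then b * w ^ 2 else 0) := by
  let y : (Fin d ⊕ ReluReg → ℝ) →ₗ[ℝ] ℝ := (R : ℝ) • LinearMap.proj (Sum.inl k₀)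
  let bit : C(EuclideanSpace ℝ (Fin d), ℝ) :=
    ⟨fun x => relu (f x (Sum.inr code) + (1 - 2 ^ n)) - relu (f x (Sum.inr code) - 2 ^ n),
      by fun_prop⟩
  let e : C(EuclideanSpace ℝ (Fin d), ℝ) := ⟨fun x => bit x + hat (R * x k₀ - n) - 1, by fun_prop⟩
  let g₁ : C(EuclideanSpace ℝ (Fin d), Fin d ⊕ ReluReg → ℝ) :=
    ⟨fun x => Sum.elim (fun i => f x (Sum.inl i)) fun r => match r with
      | pen => f x (Sum.inr pen)
      | code => f x (Sum.inr code) - 2 ^ n * bit x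
      | lab => f x (Sum.inr lab)
      | labSq => f x (Sum.inr labSq)
      | tmp => e x, continuous_pi fun i => by rcases i with i | (_ | _ | _ | _ | _) <;>
        simp only [Sum.elim_inl, Sum.elim_inr] <;> fun_prop⟩
  let g₂ : C(EuclideanSpace ℝ (Fin d), Fin d ⊕ ReluReg → ℝ) :=
    ⟨fun x => Sum.elim (fun i => f x (Sum.inl i)) fun r => match r with
      | pen => f x (Sum.inr pen)
      | code => f x (Sum.inr code) - 2 ^ n * bit x
      | lab => f x (Sum.inr lab) + w * relu (e x)
      | labSq => f x (Sum.inr labSq) + w ^ 2 * relu (e x)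
      | tmp => e x, continuous_pi fun i => by rcases i with i | (_ | _ | _ | _ | _) <;>
        simp only [Sum.elim_inl, Sum.elim_inr] <;> fun_prop⟩
  have h₁ : g₁ ∈ reluRealizable d (T + 1) := by
    refine reluRealizable_step hf
      ![LinearMap.proj (Sum.inr code), LinearMap.proj (Sum.inr code), y, y, y]
      ![1 - 2 ^ n, - 2 ^ n, 1 - n, - n, - 1 - n]
      ![Pi.single (Sum.inr code) (- 2 ^ n) + Pi.single (Sum.inr tmp) 1,
        Pi.single (Sum.inr code) (2 ^ n) + Pi.single (Sum.inr tmp) (-1),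
        Pi.single (Sum.inr tmp) 1, Pi.single (Sum.inr tmp) (-2), Pi.single (Sum.inr tmp) 1]
      (LinearMap.pi fun i => if i = Sum.inr tmp then 0 else LinearMap.proj i)
      (Pi.single (Sum.inr tmp) (-1)) fun x => ?_
    funext i
    rcases i with i | (_ | _ | _ | _ | _) <;>
      simp [g₁, Fin.sum_univ_five, e, bit, hat, y, hx] <;> ring_nf
  have h₂ : g₂ ∈ reluRealizable d (T + 2) := by
    refine reluRealizable_step h₁ ![LinearMap.proj (Sum.inr tmp), 0, 0, 0, 0] 0
      ![Pi.single (Sum.inr lab) w + Pi.single (Sum.inr labSq) (w ^ 2), 0, 0, 0, 0]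
      LinearMap.id 0 fun x => ?_
    funext i
    rcases i with i | (_ | _ | _ | _ | _) <;>
      simp [g₁, g₂, Fin.sum_univ_five] <;> ring
  refine ⟨g₂, h₂, hx, fun x => rfl, fun x a b J ha hb hcode hJ => ?_⟩
  have ha' : (a : ℝ) + 1 ≤ 2 ^ n := by exact_mod_cast ha
  have ha0 : (0 : ℝ) ≤ a := Nat.cast_nonneg a
  have hbit : bit x = b := by
    simp only [bit, relu, ContinuousMap.coe_mk, hcode]
    interval_cases b
    · push_cast
      rw [max_eq_left (by linarith), max_eq_left (by linarith)]
      simp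
    · push_cast
      rw [max_eq_right (by linarith), max_eq_right (by linarith)]
      ring
  have he : relu (e x) = if J = n then (b : ℝ) else 0 := by
    have hh : hat (R * x k₀ - n) = if J = n then 1 else 0 := by
      rw [hJ]
      have := hat_intCast ((J : ℤ) - n)
      push_cast at this
      rw [this]
      exact if_congr (by omega) rfl rfl
    simp only [e, relu, ContinuousMap.coe_mk, hbit, hh]
    split_ifs
    · simp
    · have : (b : ℝ) ≤ 1 := by exact_mod_cast hb
      exact max_eq_left (by linarith)
  refine ⟨?_, ?_, ?_⟩
  · change f x (Sum.inr code) - 2 ^ n * bit x = a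
    rw [hcode, hbit]
    push_cast
    ring
  · change f x (Sum.inr lab) + w * relu (e x) = _
    rw [he]
    split_ifs <;> ring
  · change f x (Sum.inr labSq) + w ^ 2 * relu (e x) = _
    rw [he]
    split_ifs <;> ring

theorem sum_bits_lt {b : ℕ → ℕ} (hb : ∀ j, b j ≤ 1) (n : ℕ) :
    ∑ j ∈ Finset.range n, b j * 2 ^ j < 2 ^ n := by
  induction n with
  | zero => simp
  | succ n ih =>
    rw [Finset.sum_range_succ, pow_succ]
    have := Nat.mul_le_mul_right (2 ^ n) (hb n)
    omega

/-- Decoding `n` bits, beginning with the leading one, takes `2 * n` layers. -/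
theorem reluRealizable_decode (k₀ : Fin d) (R : ℕ) (w : ℕ → ℝ) (n : ℕ) : ∀ {T : ℕ}
    {f : C(EuclideanSpace ℝ (Fin d), Fin d ⊕ ReluReg → ℝ)}, f ∈ reluRealizable d T →
    (∀ x i, f x (Sum.inl i) = x i) →
    ∃ g ∈ reluRealizable d (T + 2 * n),
      (∀ x, g x (Sum.inr pen) = f x (Sum.inr pen)) ∧
      ∀ x, ∀ (b : ℕ → ℕ) (J : ℕ), (∀ j, b j ≤ 1) →
        f x (Sum.inr code) = ((∑ j ∈ Finset.range n, b j * 2 ^ j : ℕ) : ℝ) → R * x k₀ = J →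
        g x (Sum.inr lab) = f x (Sum.inr lab) + (if J < n then b J * w J else 0) ∧
        g x (Sum.inr labSq) = f x (Sum.inr labSq) + (if J < n then b J * w J ^ 2 else 0) := by
  induction n with
  | zero => exact fun {T f} hf _ => ⟨f, hf, fun _ => rfl, fun x b J _ _ _ => by simp⟩
  | succ n ih =>
    intro T f hf hx
    obtain ⟨f₁, h₁, hx₁, hp₁, hd₁⟩ := reluRealizable_decode_bit k₀ R n (w n) hf hx
    obtain ⟨g, hg, hp, hd⟩ := ih h₁ hx₁
    refine ⟨g, by rwa [show T + 2 * (n + 1) = T + 2 + 2 * n by ring], fun x => by rw [hp, hp₁],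
      fun x b J hb hcode hJ => ?_⟩
    rw [Finset.sum_range_succ] at hcode
    obtain ⟨e1, e2, e3⟩ := hd₁ x _ (b n) J (sum_bits_lt hb n) (hb n) hcode hJ
    obtain ⟨e4, e5⟩ := hd x b J hb e1 hJ
    rw [e4, e5, e2, e3]
    rcases lt_trichotomy J n with h | rfl | h
    · simp [h, h.ne, h.trans (Nat.lt_succ_self n)]
    · simp
    · simp [h.ne', not_lt.2 h.le, not_lt.2 (Nat.succ_le_of_lt h)]

end Relu

section

open ReluReg

/-- Networks for labelled grids. The code of a column of the grid in direction `0` is the number whose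
binary digits tell which points of the column are marked. It is a function of an integer that
numbers the columns and is interpolated by hat functions, one layer per column; the digits are then
decoded one after the other. In this way the number of layers is of the order of the number of
columns and not of the number of grid points. -/
theorem exists_reluRealizable_grid (d N R : ℕ) (hR : 0 < R)
    (mark : (Fin (d + 1) → Fin (R + 1)) → Prop) :
    ∃ G s q : C(EuclideanSpace ℝ (Fin (d + 1)), ℝ), (∀ x, 0 ≤ G x) ∧
      (∀ x ∈ unitCube (d + 1), G x = 0 → ∃ i : Fin (d + 1) → Fin (R + 1), x = gridPoint i) ∧
      (∀ i : Fin (d + 1) → Fin (R + 1), G (gridPoint i) = 0 ∧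
        s (gridPoint i) = gridLabel N 0 mark i ∧
        q (gridPoint i) = (gridLabel N 0 mark i : ℝ) ^ 2) ∧
      ∀ Λ : ℝ, ∃ f ∈ realizable relu (d + 1) ((Fin (d + 1) ⊕ ReluReg) ⊕ Fin 5)
          {(d + 1) * R + (R + 1) ^ d + 2 * (R + 1)} (Fin 2),
        ∀ x, f x 0 = s x ∧ f x 1 = q x + Λ * G x := by
  classical
  have hR0 : (0 : ℝ) < R := by exact_mod_cast hR
  let bit : Fin ((R + 1) ^ d) → ℕ → ℕ := fun m j =>
    if ∃ h : j < R + 1, mark (Fin.cons ⟨j, h⟩ (finFunctionFinEquiv.symm m)) then 1 else 0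
  have hbit : ∀ m j, bit m j ≤ 1 := fun m j => by simp only [bit]; split_ifs <;> simp
  let L₀ : EuclideanSpace ℝ (Fin (d + 1)) →ₗ[ℝ] (Fin (d + 1) ⊕ ReluReg → ℝ) :=
    LinearMap.pi (Sum.elim (fun i => LinearMap.proj i ∘ₗ
      (WithLp.linearEquiv 2 ℝ (Fin (d + 1) → ℝ)).toLinearMap) 0)
  let f₀ : C(EuclideanSpace ℝ (Fin (d + 1)), Fin (d + 1) ⊕ ReluReg → ℝ) :=
    ⟨L₀, L₀.continuous_of_finiteDimensional⟩
  have h₀ : f₀ ∈ reluRealizable (d + 1) 0 :=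
    affine_mem_realizable (Set.mem_singleton 0) L₀ 0 fun x => (add_zero _).symm
  have hr₀ : ∀ x r, f₀ x (Sum.inr r) = 0 := fun x r => rfl
  obtain ⟨f₁, h₁, hx₁, hr₁, hp₁⟩ := reluRealizable_add_hats (α := Fin (d + 1) × Fin R) pen
    (fun a => (2 * R : ℝ) • LinearMap.proj a.1) 1 (fun a => 2 * a.2 + 1) Finset.univ h₀
    (fun x i => rfl)
  obtain ⟨f₂, h₂, hx₂, hr₂, hp₂⟩ := reluRealizable_add_hats (α := Fin ((R + 1) ^ d)) code
    (fun _ => ∑ k : Fin d, (R * (R + 1) ^ (k : ℕ) : ℝ) • LinearMap.proj k.succ)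
    (fun m => ((∑ j ∈ Finset.range (R + 1), bit m j * 2 ^ j : ℕ) : ℝ)) (fun m => m)
    Finset.univ h₁ hx₁
  obtain ⟨f₃, h₃, hp₃, hd₃⟩ := reluRealizable_decode 0 R (fun j => (j % (N + 1) + 1 : ℕ)) (R + 1)
    h₂ hx₂
  have hpen : ∀ x, f₃ x (Sum.inr pen) =
      ∑ a : Fin (d + 1) × Fin R, hat (2 * R * x a.1 - (2 * a.2 + 1)) := fun x => by
    rw [hp₃, hr₂ _ (by decide), hp₁]
    simp [hr₀]
  refine ⟨⟨fun x => f₃ x (Sum.inr pen), by fun_prop⟩, ⟨fun x => f₃ x (Sum.inr lab), by fun_prop⟩,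
    ⟨fun x => f₃ x (Sum.inr labSq), by fun_prop⟩, ?_, ?_, ?_, ?_⟩
  · intro x
    simp only [ContinuousMap.coe_mk, hpen]
    exact Finset.sum_nonneg fun _ _ => hat_nonneg _
  · intro x hx h0
    simp only [ContinuousMap.coe_mk, hpen] at h0
    rw [Finset.sum_eq_zero_iff_of_nonneg fun _ _ => hat_nonneg _] at h0
    -- a coordinate that is not a multiple of `1 / R` lies under the hat between two multiples
    have hk : ∀ k, (⌊R * x k⌋₊ : ℝ) = R * x k := fun k => by
      have hy0 : 0 ≤ R * x k := mul_nonneg hR0.le (hx k).1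
      have h1 := Nat.floor_le hy0
      have h2 := Nat.lt_floor_add_one (R * x k)
      by_contra hne
      have h3 : (⌊R * x k⌋₊ : ℝ) < R * x k := lt_of_le_of_ne h1 hne
      have h4 : ⌊R * x k⌋₊ < R := by
        have : R * x k ≤ R := by nlinarith [(hx k).2]
        exact_mod_cast h3.trans_le this
      have h5 := h0 (k, ⟨_, h4⟩) (Finset.mem_univ _)
      refine absurd h5 (hat_pos ?_).ne'
      rw [abs_lt]
      constructor <;> simp only <;> linarith
    refine ⟨fun k => ⟨⌊R * x k⌋₊, ?_⟩, ?_⟩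
    · have : (⌊R * x k⌋₊ : ℝ) ≤ R := by rw [hk]; nlinarith [(hx k).2]
      exact Nat.lt_succ_of_le (by exact_mod_cast this)
    · ext k
      simp only [gridPoint, hk]
      field_simp
  · intro i
    have hi : ∀ k, (R : ℝ) * gridPoint i k = (i k : ℕ) := fun k => by
      simp only [gridPoint]
      field_simp
    set m₀ := finFunctionFinEquiv fun k => i k.succ with hm₀
    have hm₀' : ((m₀ : ℕ) : ℝ) = ∑ k : Fin d, (i k.succ : ℕ) * ((R : ℝ) + 1) ^ (k : ℕ) := by
      rw [hm₀, finFunctionFinEquiv_apply]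
      push_cast
      rfl
    have hcode : f₂ (gridPoint i) (Sum.inr code) =
        ((∑ j ∈ Finset.range (R + 1), bit m₀ j * 2 ^ j : ℕ) : ℝ) := by
      have hcol : (∑ k : Fin d, (R * (R + 1) ^ (k : ℕ) : ℝ) •
          (LinearMap.proj k.succ : (Fin (d + 1) → ℝ) →ₗ[ℝ] ℝ)) (gridPoint i) = (m₀ : ℕ) := by
        rw [hm₀']
        simp only [LinearMap.sum_apply, LinearMap.smul_apply, LinearMap.proj_apply, smul_eq_mul]
        refine Finset.sum_congr rfl fun k _ => ?_
        rw [← hi]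
        ring
      rw [hp₂, hr₁ _ (by decide), Finset.sum_eq_single m₀]
      · rw [hcol, sub_self]
        simp [hr₀, hat_eq]
      · intro m _ hm
        have hne : ((m₀ : ℕ) : ℤ) - (m : ℕ) ≠ 0 := fun h => hm (Fin.ext (by omega))
        have := hat_intCast (((m₀ : ℕ) : ℤ) - (m : ℕ))
        rw [if_neg hne] at this
        push_cast at this
        rw [hcol, this, mul_zero]
      · simp
    obtain ⟨e1, e2⟩ := hd₃ (gridPoint i) (bit m₀) (i 0) (hbit m₀) hcode (hi 0)
    have hcons : (Fin.cons ⟨(i 0 : ℕ), (i 0).2⟩ (finFunctionFinEquiv.symm m₀) :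
        Fin (d + 1) → Fin (R + 1)) = i := by
      rw [hm₀, Equiv.symm_apply_apply]
      exact Fin.cons_self_tail i
    have hb : bit m₀ (i 0) = if mark i then 1 else 0 := by
      simp only [bit]
      refine if_congr ⟨fun ⟨_, h⟩ => hcons ▸ h, fun h => ⟨(i 0).2, hcons.symm ▸ h⟩⟩ rfl rfl
    rw [if_pos (i 0).2] at e1 e2
    refine ⟨?_, ?_, ?_⟩
    · simp only [ContinuousMap.coe_mk, hpen]
      refine Finset.sum_eq_zero fun a _ => hat_eq_zero ?_
      have h1 : (1 : ℤ) ≤ |2 * ((i a.1 : ℕ) : ℤ) - (2 * ((a.2 : ℕ) : ℤ) + 1)| :=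
        Int.one_le_abs (by omega)
      have h2 : (2 * R * gridPoint i a.1 - (2 * ((a.2 : ℕ) : ℝ) + 1)) =
          ((2 * ((i a.1 : ℕ) : ℤ) - (2 * ((a.2 : ℕ) : ℤ) + 1) : ℤ) : ℝ) := by
        push_cast
        rw [← hi]
        ring
      rw [h2]
      exact_mod_cast h1
    · simp only [ContinuousMap.coe_mk, e1, hb, hr₂ lab (by decide), hr₁ lab (by decide), gridLabel]
      split_ifs <;> simp [hr₀]
    · simp only [ContinuousMap.coe_mk, e2, hb, hr₂ labSq (by decide), hr₁ labSq (by decide),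
        gridLabel]
      split_ifs <;> simp [hr₀]
  · intro Λ
    have hT : 0 + (Finset.univ : Finset (Fin (d + 1) × Fin R)).card +
        (Finset.univ : Finset (Fin ((R + 1) ^ d))).card + 2 * (R + 1) =
        (d + 1) * R + (R + 1) ^ d + 2 * (R + 1) := by simp
    rw [hT] at h₃
    refine ⟨⟨fun x => ![f₃ x (Sum.inr lab), f₃ x (Sum.inr labSq) + Λ * f₃ x (Sum.inr pen)],
      by fun_prop⟩, realizable_affine h₃ (LinearMap.pi ![LinearMap.proj (Sum.inr lab),
        LinearMap.proj (Sum.inr labSq) + Λ • LinearMap.proj (Sum.inr pen)]) 0 fun x => ?_,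
      fun x => ⟨rfl, rfl⟩⟩
    ext j
    fin_cases j <;> simp

end

/-- The resolution `R` of the grid for accuracy `ε`: it is fine enough, and at most a multiple of
`1 / ε`. -/
theorem exists_resolution {d : ℕ} (hd : 0 < d) (N : ℕ) {ε : ℝ} (hε : 0 < ε) (hε1 : ε ≤ 1) :
    ∃ R : ℕ, N + 1 ≤ R ∧ 2 * (d * ((N + 1) / R : ℝ)) ≤ ε ∧
      ((R : ℝ) + 1) ≤ 4 * d * (N + 1) * ε⁻¹ := by
  have hd1 : (1 : ℝ) ≤ d := by exact_mod_cast hd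
  have hN : (0 : ℝ) ≤ N := Nat.cast_nonneg N
  have hinv : 1 ≤ ε⁻¹ := (one_le_inv₀ hε).2 hε1
  have hy : (N : ℝ) + 1 ≤ 2 * d * (N + 1) * ε⁻¹ := by
    have h1 : (N : ℝ) + 1 ≤ (N + 1) * (d * ε⁻¹) :=
      le_mul_of_one_le_right (by positivity) (one_le_mul_of_one_le_of_one_le hd1 hinv)
    have h2 : 0 ≤ (N + 1) * (d * ε⁻¹) := by positivity
    linarith
  have hy2 : 2 ≤ 2 * d * (N + 1) * ε⁻¹ := by
    have h1 : (1 : ℝ) ≤ (N + 1) * (d * ε⁻¹) :=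
      one_le_mul_of_one_le_of_one_le (by linarith) (one_le_mul_of_one_le_of_one_le hd1 hinv)
    linarith
  have hceil := Nat.le_ceil (2 * d * (N + 1) * ε⁻¹)
  have hlt := Nat.ceil_lt_add_one (a := 2 * d * (N + 1) * ε⁻¹) (by positivity)
  refine ⟨⌈2 * d * (N + 1) * ε⁻¹⌉₊, ?_, ?_, by linarith⟩
  · exact_mod_cast hy.trans hceil
  · have hR0 : (0 : ℝ) < ⌈2 * d * (N + 1) * ε⁻¹⌉₊ := by linarith
    rw [show (2 * (d * ((N + 1) / ⌈2 * d * (N + 1) * ε⁻¹⌉₊)) : ℝ) =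
      2 * d * (N + 1) / ⌈2 * d * (N + 1) * ε⁻¹⌉₊ by ring, div_le_iff₀ hR0]
    calc (2 * d * (N + 1) : ℝ) = ε * (2 * d * (N + 1) * ε⁻¹) := by field_simp
      _ ≤ _ := by gcongr

/-- Approximation of compact subsets of the unit cube by deep zero-sets of ReLU networks. -/
theorem exists_approximatesSets_relu {d : ℕ} (hd : 2 ≤ d) (N : ℕ) :
    ∃ b C : ℝ, 0 < b ∧ 0 < C ∧
      ∀ K : Fin N → Set (EuclideanSpace ℝ (Fin d)),
        (∀ n, (K n).Nonempty ∧ IsCompact (K n) ∧ K n ⊆ unitCube d) →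
      ∀ ε : ℝ, 0 < ε → ε ≤ 1 → ∀ γ ∈ Set.Ioo (0 : ℝ) 1,
        ∃ c : FFNN N d, c.HasConstantWidth (2 * d + 10) ∧
          (c.depth : ℝ) ≤ C * (b * ε) ^ (-(d : ℤ) + 1) ∧
          c.ApproximatesSets (fun x => max 0 x) (unitCube d) γ K ε := by
  obtain ⟨d, rfl⟩ := Nat.exists_eq_add_of_le' (show 1 ≤ d by omega)
  refine ⟨1, (d + 4) * (4 * (d + 1 : ℕ) * (N + 1)) ^ d, one_pos, by positivity,
    fun K hK ε hε hε1 γ hγ => ?_⟩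
  obtain ⟨R, hNR, hR, hR4⟩ := exists_resolution (Nat.succ_pos d) N hε hε1
  obtain ⟨e⟩ : Nonempty ((Fin (d + 1) ⊕ ReluReg) ⊕ Fin 5 ↪ Fin (2 * (d + 1) + 10)) := by
    refine Function.Embedding.nonempty_of_card_le ?_
    simp only [Fintype.card_sum, Fintype.card_fin, show Fintype.card ReluReg = 5 from rfl]
    omega
  obtain ⟨c, h1, h2, h3⟩ := exists_approximatesSets_of_grid e 0 hε hNR hR
    (exists_reluRealizable_grid d N R (by omega)) hK hγ
  refine ⟨c, h1, ?_, h3⟩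
  have hpow : R + 1 ≤ (R + 1) ^ d := Nat.le_self_pow (by omega) _
  have hdepth : c.depth ≤ (d + 4) * (R + 1) ^ d := by
    rw [h2]
    calc (d + 1) * R + (R + 1) ^ d + 2 * (R + 1) + 1 ≤ (R + 1) ^ d + (d + 3) * (R + 1) := by
          ring_nf
          omega
      _ ≤ (R + 1) ^ d + (d + 3) * (R + 1) ^ d := by gcongr
      _ = (d + 4) * (R + 1) ^ d := by ring
  calc (c.depth : ℝ) ≤ (d + 4) * ((R : ℝ) + 1) ^ d := by exact_mod_cast hdepth
    _ ≤ (d + 4) * (4 * (d + 1 : ℕ) * (N + 1) * ε⁻¹) ^ d := by gcongr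
    _ = (d + 4) * (4 * (d + 1 : ℕ) * (N + 1)) ^ d * (1 * ε) ^ (-((d + 1 : ℕ) : ℤ) + 1) := by
      rw [mul_pow, one_mul, show -((d + 1 : ℕ) : ℤ) + 1 = -(d : ℤ) by push_cast; ring,
        zpow_neg, zpow_natCast, inv_pow]
      ring

/-! ### Smooth activation functions: exact polynomial arithmetic in the limit -/

/-- A smooth function that is not affine has a point where its first two derivatives do not
vanish. -/
theorem exists_deriv_ne_zero_and_deriv_deriv_ne_zero {σ : ℝ → ℝ} (hσ : ContDiff ℝ 2 σ)
    (hna : ¬ ∃ a b : ℝ, ∀ x, σ x = a * x + b) :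
    ∃ x, deriv σ x ≠ 0 ∧ deriv (deriv σ) x ≠ 0 := by
  have hd : Differentiable ℝ σ := hσ.differentiable (by norm_num)
  have h1 : ContDiff ℝ 1 (deriv σ) := by
    have : ContDiff ℝ (1 + 1) σ := by simpa [one_add_one_eq_two] using hσ
    exact (contDiff_succ_iff_deriv.1 this).2.2
  have hd1 : Differentiable ℝ (deriv σ) := h1.differentiable (by norm_num)
  have hc2 : Continuous (deriv (deriv σ)) := h1.continuous_deriv le_rfl
  obtain ⟨a, ha⟩ : ∃ a, deriv (deriv σ) a ≠ 0 := by
    by_contra! H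
    have hconst : ∀ x, deriv σ x = deriv σ 0 := fun x => is_const_of_deriv_eq_zero hd1 H x 0
    refine hna ⟨deriv σ 0, σ 0, fun x => ?_⟩
    have hdx : ∀ x, HasDerivAt (fun x => σ x - deriv σ 0 * x) 0 x := fun x =>
      (((hd x).hasDerivAt).sub ((hasDerivAt_id x).const_mul (deriv σ 0))).congr_deriv
        (by rw [hconst]; ring)
    have := is_const_of_deriv_eq_zero (fun x => (hdx x).differentiableAt)
      (fun x => (hdx x).deriv) x 0
    simp only [mul_zero, sub_zero] at this
    linarith
  have e1 := (hd1 a).hasDerivAt.eventually_ne ha (c := 0)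
  have e2 : ∀ᶠ z in nhdsWithin a {a}ᶜ, deriv (deriv σ) z ≠ 0 :=
    (hc2.continuousAt.eventually_ne ha).filter_mono nhdsWithin_le_nhds
  exact (e1.and e2).exists

section Smooth

variable {σ : C(ℝ, ℝ)} {d : ℕ} {κ : Type} [Fintype κ] [DecidableEq κ]

/-- If a function has non-zero first and second derivatives at `x₁`, a layer with one neuron for each
register can add a multiple of the square of one register to another one. The neuron for the
register `j` computes `σ (x₁ + t y)`, from which `y` itself is recovered up to `O(t)`. The neuron for
the register `i` cancels the terms of order zero and one in the expansion of `σ (x₁ + t y)`, so that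
no additional neuron is needed. -/
theorem realizable_add_sq {x₁ : ℝ} (hσ : ContDiff ℝ 2 σ) (h1 : deriv σ x₁ ≠ 0)
    (h2 : deriv (deriv σ) x₁ ≠ 0) {T : ℕ} {f : C(EuclideanSpace ℝ (Fin d), κ → ℝ)}
    (hf : f ∈ realizable σ d κ {T} κ) {i j : κ} (hij : i ≠ j) (c : ℝ)
    {g : C(EuclideanSpace ℝ (Fin d), κ → ℝ)}
    (hg : ∀ x k, g x k = f x k + if k = i then c * f x j ^ 2 else 0) :
    g ∈ realizable σ d κ {T + 1} κ := by
  have hdiff : DifferentiableAt ℝ σ x₁ := hσ.differentiable (by norm_num) x₁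
  have hds := continuous_dslope σ.continuous hdiff
  have hR := continuous_secondRemainder (a := x₁) hσ
  refine realizable_of_punctured (Φ := fun p k =>
    if k = j then f p.2 j * dslope σ x₁ (x₁ + p.1 * f p.2 j) / deriv σ x₁
    else f p.2 k + if k = i then c * (f p.2 j ^ 2 * secondRemainder σ x₁ (p.1 * f p.2 j)) else 0)
    ?_ ?_ ?_
  · refine continuous_pi fun k => ?_
    split_ifs <;> fun_prop
  · intro t ht g hg
    set δ := 2 * c / (deriv (deriv σ) x₁ * t ^ 2) with hδ
    let L : (κ → ℝ) →ₗ[ℝ] (κ → ℝ) := LinearMap.pi fun k =>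
      if k = j then t • LinearMap.proj j
      else if k = i then LinearMap.proj i - (δ * deriv σ x₁ * t) • LinearMap.proj j
      else LinearMap.proj k
    let L' : (κ → ℝ) →ₗ[ℝ] (κ → ℝ) := LinearMap.pi fun k =>
      if k = j then (t * deriv σ x₁)⁻¹ • LinearMap.proj j
      else if k = i then LinearMap.proj i + δ • LinearMap.proj j
      else LinearMap.proj k
    let v : κ → ℝ := Pi.single j x₁
    have hm : Continuous fun x k => (if k = j then σ ((L (f x) + v) k)
        else (L (f x) + v) k : ℝ) := by
      have hL : Continuous fun x => L (f x) + v :=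
        ((continuous_pi fun k => (LinearMap.proj k ∘ₗ L).continuous_on_pi).comp
          f.continuous).add continuous_const
      refine continuous_pi fun k => ?_
      split_ifs
      · exact σ.continuous.comp ((continuous_apply k).comp hL)
      · exact (continuous_apply k).comp hL
    have hmix := realizable_mix (S' := {T + 1}) hdiff h1 (by simp) hf (fun k => k = j) L
      v (g := ⟨_, hm⟩) (fun x k => rfl)
    refine realizable_affine hmix L' (fun k => if k = j then - σ x₁ / (t * deriv σ x₁)
      else if k = i then - δ * σ x₁ else 0) fun x => ?_
    rw [hg]
    funext k
    by_cases hkj : k = j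
    · subst hkj
      have := sub_smul_dslope σ x₁ (x₁ + t * f x k)
      simp only [add_sub_cancel_left, smul_eq_mul] at this
      simp [L, L', v]
      rw [add_comm (t * f x k) x₁, eq_add_of_sub_eq this.symm]
      field_simp
      ring
    · by_cases hki : k = i
      · subst hki
        have := sq_mul_secondRemainder h2 (t * f x j)
        simp [L, L', v, hkj]
        have h3 : f x j ^ 2 * secondRemainder σ x₁ (t * f x j) =
            2 / (deriv (deriv σ) x₁ * t ^ 2) *
              (σ (x₁ + t * f x j) - σ x₁ - deriv σ x₁ * (t * f x j)) := by
          rw [← this]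
          field_simp
        rw [h3, hδ, add_comm (t * f x j) x₁]
        ring
      · simp [L, L', v, hkj, hki]
  · intro x
    funext k
    rw [hg]
    by_cases hkj : k = j
    · subst hkj
      simp [hij.symm, dslope_same]
      field_simp
    · simp [hkj, secondRemainder_zero hσ h2]

/-- Products are obtained from squares by polarization. -/
theorem realizable_add_mul {x₁ : ℝ} (hσ : ContDiff ℝ 2 σ) (h1 : deriv σ x₁ ≠ 0)
    (h2 : deriv (deriv σ) x₁ ≠ 0) {T : ℕ} {f : C(EuclideanSpace ℝ (Fin d), κ → ℝ)}
    (hf : f ∈ realizable σ d κ {T} κ) {i j l : κ} (hij : i ≠ j) (hil : i ≠ l) (hjl : j ≠ l)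
    {g : C(EuclideanSpace ℝ (Fin d), κ → ℝ)}
    (hg : ∀ x k, g x k = f x k + if k = i then f x j * f x l else 0) :
    g ∈ realizable σ d κ {T + 2} κ := by
  have hadd : ∀ (a : ℝ) {T : ℕ} {f : C(EuclideanSpace ℝ (Fin d), κ → ℝ)},
      f ∈ realizable σ d κ {T} κ → ∃ f' ∈ realizable σ d κ {T} κ,
      ∀ x k, f' x k = f x k + if k = j then a * f x l else 0 := fun a {T} f hf => by
    refine ⟨⟨fun x k => f x k + if k = j then a * f x l else 0, continuous_pi fun k => by
      split_ifs <;> fun_prop⟩, ?_, fun x k => rfl⟩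
    refine realizable_affine hf (LinearMap.id + LinearMap.pi fun k =>
      if k = j then a • LinearMap.proj l else 0) 0 fun x => ?_
    funext k
    by_cases hk : k = j <;> simp [hk]
  have hsq : ∀ (a : ℝ) {T : ℕ} {f : C(EuclideanSpace ℝ (Fin d), κ → ℝ)},
      f ∈ realizable σ d κ {T} κ → ∃ f' ∈ realizable σ d κ {T + 1} κ,
      ∀ x k, f' x k = f x k + if k = i then a * f x j ^ 2 else 0 := fun a {T} f hf =>
    ⟨⟨fun x k => f x k + if k = i then a * f x j ^ 2 else 0, continuous_pi fun k => by
      split_ifs <;> fun_prop⟩, realizable_add_sq hσ h1 h2 hf hij a fun x k => rfl, fun x k => rfl⟩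
  obtain ⟨f₁, m₁, e₁⟩ := hadd 1 hf
  obtain ⟨f₂, m₂, e₂⟩ := hsq (1 / 4) m₁
  obtain ⟨f₃, m₃, e₃⟩ := hadd (-2) m₂
  obtain ⟨f₄, m₄, e₄⟩ := hsq (-1 / 4) m₃
  obtain ⟨f₅, m₅, e₅⟩ := hadd 1 m₄
  convert m₅ using 1
  ext x k
  simp only [hg, e₅, e₄, e₃, e₂, e₁]
  by_cases hki : k = i
  · subst hki
    simp [hij, hij.symm, hil.symm, hjl.symm]
    ring
  · by_cases hkj : k = j
    · subst hkj
      simp [hij.symm, hil.symm, hjl.symm]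
      ring
    · simp [hki, hkj]

/-- Horner's scheme: a polynomial of degree at most `n` in a register `k` can be evaluated in the
register `acc` by `2 * n` layers, with the help of the register `tmp`. -/
theorem realizable_horner {x₁ : ℝ} (hσ : ContDiff ℝ 2 σ) (h1 : deriv σ x₁ ≠ 0)
    (h2 : deriv (deriv σ) x₁ ≠ 0) {acc tmp k : κ} (hat : acc ≠ tmp) (hak : acc ≠ k)
    (htk : tmp ≠ k) (n : ℕ) : ∀ (p : Polynomial ℝ), p.natDegree ≤ n →
    ∀ {T : ℕ} {f : C(EuclideanSpace ℝ (Fin d), κ → ℝ)}, f ∈ realizable σ d κ {T} κ →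
    ∃ g ∈ realizable σ d κ {T + 2 * n} κ, (∀ x, g x acc = p.eval (f x k)) ∧
      ∀ x l, l ≠ acc → l ≠ tmp → g x l = f x l := by
  induction n with
  | zero =>
    intro p hp T f hf
    rw [Polynomial.eq_C_of_natDegree_le_zero hp]
    refine ⟨⟨fun x l => if l = acc then p.coeff 0 else f x l, continuous_pi fun l => by
      split_ifs <;> fun_prop⟩, ?_, fun x => by simp, fun x l hl _ => by simp [hl]⟩
    refine realizable_affine hf (LinearMap.pi fun l => if l = acc then 0 else LinearMap.proj l)
      (Pi.single acc (p.coeff 0)) fun x => ?_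
    funext l
    by_cases hl : l = acc
    · subst hl; simp
    · simp [hl]
  | succ n ih =>
    intro p hp T f hf
    obtain ⟨f₁, m₁, e₁, o₁⟩ := ih p.divX
      (by rw [Polynomial.natDegree_divX_eq_natDegree_tsub_one]; omega) hf
    let f₂ : C(EuclideanSpace ℝ (Fin d), κ → ℝ) :=
      ⟨fun x l => if l = tmp then 0 else f₁ x l, continuous_pi fun l => by
        split_ifs <;> fun_prop⟩
    have m₂ : f₂ ∈ realizable σ d κ {T + 2 * n} κ := by
      refine realizable_affine m₁
        (LinearMap.pi fun l => if l = tmp then 0 else LinearMap.proj l) 0 fun x => ?_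
      funext l
      by_cases hl : l = tmp <;> simp [f₂, hl]
    let f₃ : C(EuclideanSpace ℝ (Fin d), κ → ℝ) :=
      ⟨fun x l => f₂ x l + if l = tmp then f₂ x acc * f₂ x k else 0, continuous_pi fun l => by
        split_ifs <;> fun_prop⟩
    have m₃ : f₃ ∈ realizable σ d κ {T + 2 * n + 2} κ :=
      realizable_add_mul hσ h1 h2 m₂ hat.symm htk hak fun x l => rfl
    refine ⟨⟨fun x l => if l = acc then f₃ x tmp + p.coeff 0 else f₃ x l,
      continuous_pi fun l => by split_ifs <;> fun_prop⟩, ?_, fun x => ?_, fun x l hl hl' => ?_⟩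
    · rw [show T + 2 * (n + 1) = T + 2 * n + 2 by ring]
      refine realizable_affine m₃
        (LinearMap.pi fun l => if l = acc then LinearMap.proj tmp else LinearMap.proj l)
        (Pi.single acc (p.coeff 0)) fun x => ?_
      funext l
      by_cases hl : l = acc
      · subst hl; simp
      · simp [hl]
    · have : p.eval (f x k) = p.divX.eval (f x k) * f x k + p.coeff 0 := by
        conv_lhs => rw [← Polynomial.divX_mul_X_add p]
        simp
      simp [f₃, f₂, hat, htk.symm, this, e₁, o₁ x k hak.symm htk.symm]
    · simp [f₃, f₂, hl, hl', o₁ x l hl hl']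

end Smooth

/-- The registers of the network with smooth activation function besides those for the input: an
accumulator for Horner's scheme, a sum of squares, and an intermediate result. -/
inductive SmoothReg
  | acc | sum | tmp
  deriving DecidableEq

instance : Fintype SmoothReg where
  elems := {.acc, .sum, .tmp}
  complete r := by cases r <;> decide

section

open SmoothReg

variable {σ : C(ℝ, ℝ)} {d : ℕ}

/-- The maps that are realized by `T` layers with one neuron for each register. -/
abbrev smoothRealizable (σ : C(ℝ, ℝ)) (d T : ℕ) :
    Set C(EuclideanSpace ℝ (Fin d), Fin d ⊕ SmoothReg → ℝ) :=
  realizable σ d (Fin d ⊕ SmoothReg) {T} (Fin d ⊕ SmoothReg)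

/-- The square of a polynomial of degree at most `n` in a register for the input can be added to the
register `sum`; the value of the polynomial remains in `acc`. -/
theorem smoothRealizable_add_sq_eval {x₁ : ℝ} (hσ : ContDiff ℝ 2 σ) (h1 : deriv σ x₁ ≠ 0)
    (h2 : deriv (deriv σ) x₁ ≠ 0) (k : Fin d) {n : ℕ} {p : Polynomial ℝ} (hp : p.natDegree ≤ n)
    {T : ℕ} {f : C(EuclideanSpace ℝ (Fin d), Fin d ⊕ SmoothReg → ℝ)}
    (hf : f ∈ smoothRealizable σ d T) :
    ∃ g ∈ smoothRealizable σ d (T + (2 * n + 1)),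
      (∀ x i, g x (Sum.inl i) = f x (Sum.inl i)) ∧
      ∀ x, g x (Sum.inr acc) = p.eval (f x (Sum.inl k)) ∧
        g x (Sum.inr sum) = f x (Sum.inr sum) + p.eval (f x (Sum.inl k)) ^ 2 := by
  obtain ⟨f₁, m₁, e₁, o₁⟩ := realizable_horner (acc := Sum.inr acc) (tmp := Sum.inr tmp)
    (k := Sum.inl k) hσ h1 h2 (by simp) (by simp) (by simp) n p hp hf
  refine ⟨⟨fun x l => f₁ x l + if l = Sum.inr sum then 1 * f₁ x (Sum.inr acc) ^ 2 else 0,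
    continuous_pi fun l => by split_ifs <;> fun_prop⟩,
    realizable_add_sq hσ h1 h2 m₁ (i := Sum.inr sum) (j := Sum.inr acc) (by simp) 1
      fun x l => rfl, fun x i => ?_, fun x => ⟨?_, ?_⟩⟩
  · simp [o₁]
  · simp [e₁]
  · simp [e₁, o₁]

/-- Networks for labelled grids. The penalty is `∑ₖ h(xₖ)²`, where the polynomial `h` vanishes at the
multiples of `1 / R`. The labels are interpolated by a polynomial in an integer that numbers the
grid points. -/
theorem exists_smoothRealizable_grid {σ : C(ℝ, ℝ)} {x₁ : ℝ} (hσ : ContDiff ℝ 2 σ)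
    (h1 : deriv σ x₁ ≠ 0) (h2 : deriv (deriv σ) x₁ ≠ 0) {d : ℕ} (N R : ℕ) (hR : 0 < R)
    (k₀ : Fin d) (mark : (Fin d → Fin (R + 1)) → Prop) :
    ∃ G s q : C(EuclideanSpace ℝ (Fin d), ℝ), (∀ x, 0 ≤ G x) ∧
      (∀ x ∈ unitCube d, G x = 0 → ∃ i : Fin d → Fin (R + 1), x = gridPoint i) ∧
      (∀ i : Fin d → Fin (R + 1), G (gridPoint i) = 0 ∧
        s (gridPoint i) = gridLabel N k₀ mark i ∧
        q (gridPoint i) = (gridLabel N k₀ mark i : ℝ) ^ 2) ∧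
      ∀ Λ : ℝ, ∃ f ∈ realizable σ d (Fin d ⊕ SmoothReg)
          {d * (2 * (R + 1) + 1) + (2 * (R + 1) ^ d + 1)} (Fin 2),
        ∀ x, f x 0 = s x ∧ f x 1 = q x + Λ * G x := by
  have hR0 : (0 : ℝ) < R := by exact_mod_cast hR
  let h : Polynomial ℝ := ∏ j ∈ Finset.range (R + 1), (Polynomial.X - Polynomial.C ((j : ℝ) / R))
  have hdeg : h.natDegree ≤ R + 1 := by
    rw [Polynomial.natDegree_prod_of_monic _ _ fun j _ => Polynomial.monic_X_sub_C _]
    simp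
  have hroot : ∀ y, h.eval y = 0 ↔ ∃ j < R + 1, y = (j : ℝ) / R := fun y => by
    simp [h, Polynomial.eval_prod, Finset.prod_eq_zero_iff, sub_eq_zero]
  let S : Polynomial ℝ := Lagrange.interpolate Finset.univ
    (fun m : Fin ((R + 1) ^ d) => ((m : ℕ) : ℝ))
    (fun m => (gridLabel N k₀ mark (finFunctionFinEquiv.symm m) : ℝ))
  have hinj : Set.InjOn (fun m : Fin ((R + 1) ^ d) => ((m : ℕ) : ℝ))
      (Finset.univ : Finset (Fin ((R + 1) ^ d))) := fun a _ b _ hab =>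
    Fin.ext (Nat.cast_injective hab)
  have hSdeg : S.natDegree ≤ (R + 1) ^ d := by
    refine Polynomial.natDegree_le_of_degree_le
      ((Lagrange.degree_interpolate_lt _ hinj).le.trans ?_)
    simp
  let t : (Fin d → ℝ) →ₗ[ℝ] ℝ := ∑ k : Fin d, (R * (R + 1) ^ (k : ℕ) : ℝ) • LinearMap.proj k
  have ht : ∀ i : Fin d → Fin (R + 1), t (gridPoint i) = (finFunctionFinEquiv i : ℕ) := fun i => by
    rw [finFunctionFinEquiv_apply]
    simp only [t, LinearMap.sum_apply, LinearMap.smul_apply, LinearMap.proj_apply, smul_eq_mul,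
      gridPoint]
    push_cast
    refine Finset.sum_congr rfl fun k _ => ?_
    field_simp
  have hS : ∀ i : Fin d → Fin (R + 1), S.eval (t (gridPoint i)) = gridLabel N k₀ mark i :=
    fun i => by
      rw [ht]
      have := Lagrange.eval_interpolate_at_node
        (fun m => (gridLabel N k₀ mark (finFunctionFinEquiv.symm m) : ℝ)) hinj
        (Finset.mem_univ (finFunctionFinEquiv i))
      rwa [Equiv.symm_apply_apply] at this
  have htc : Continuous fun x : EuclideanSpace ℝ (Fin d) => t x :=
    t.continuous_on_pi.comp (by fun_prop)
  refine ⟨⟨fun x => ∑ k, h.eval (x k) ^ 2, by fun_prop⟩, ⟨fun x => S.eval (t x), by fun_prop⟩,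
    ⟨fun x => S.eval (t x) ^ 2, by fun_prop⟩, ?_,
    ?_, fun i => ⟨?_, hS i, by simp [hS]⟩, fun Λ => ?_⟩
  · intro x
    rw [ContinuousMap.coe_mk]
    positivity
  · intro x hx h0
    simp only [ContinuousMap.coe_mk] at h0
    rw [Finset.sum_eq_zero_iff_of_nonneg fun _ _ => sq_nonneg _] at h0
    choose j hj hjx using fun k => (hroot (x k)).1 (pow_eq_zero_iff two_ne_zero |>.1
      (h0 k (Finset.mem_univ k)))
    exact ⟨fun k => ⟨j k, hj k⟩, by ext k; exact hjx k⟩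
  · rw [ContinuousMap.coe_mk]
    refine Finset.sum_eq_zero fun k _ => ?_
    rw [(hroot (gridPoint i k)).2 ⟨i k, (i k).2, rfl⟩]
    simp
  · have key : ∀ u : Finset (Fin d),
        ∃ f ∈ smoothRealizable σ d (u.card * (2 * (R + 1) + 1)),
        (∀ x i, f x (Sum.inl i) = x i) ∧
        ∀ x, f x (Sum.inr sum) = ∑ k ∈ u, h.eval (x k) ^ 2 := by
      intro u
      induction u using Finset.induction_on with
      | empty =>
        let L₀ : EuclideanSpace ℝ (Fin d) →ₗ[ℝ] (Fin d ⊕ SmoothReg → ℝ) :=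
          LinearMap.pi (Sum.elim (fun i => LinearMap.proj i ∘ₗ
            (WithLp.linearEquiv 2 ℝ (Fin d → ℝ)).toLinearMap) 0)
        refine ⟨⟨L₀, L₀.continuous_of_finiteDimensional⟩, affine_mem_realizable (by simp) L₀ 0
          fun x => (add_zero _).symm, fun x i => rfl, fun x => rfl⟩
      | insert k u hk ih =>
        obtain ⟨f, hf, hx, hs⟩ := ih
        obtain ⟨g, hg, hgx, hgs⟩ := smoothRealizable_add_sq_eval hσ h1 h2 k hdeg hf
        refine ⟨g, ?_, fun x i => by rw [hgx, hx], fun x => ?_⟩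
        · rwa [Finset.card_insert_of_notMem hk, add_one_mul]
        · rw [(hgs x).2, hs, hx, Finset.sum_insert hk, add_comm]
    obtain ⟨f, hf, hx, hs⟩ := key Finset.univ
    rw [Finset.card_univ, Fintype.card_fin] at hf
    -- the register for the coordinate `k₀` is overwritten by the number of the grid point
    let f₁ : C(EuclideanSpace ℝ (Fin d), Fin d ⊕ SmoothReg → ℝ) :=
      ⟨fun x l => if l = Sum.inl k₀ then t x else if l = Sum.inr sum then Λ * f x (Sum.inr sum)
        else f x l, continuous_pi fun l => by split_ifs <;> fun_prop⟩
    have m₁ : f₁ ∈ smoothRealizable σ d (d * (2 * (R + 1) + 1)) := by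
      refine realizable_affine hf (LinearMap.pi fun l =>
        if l = Sum.inl k₀ then t ∘ₗ LinearMap.funLeft ℝ ℝ Sum.inl
        else if l = Sum.inr sum then Λ • LinearMap.proj (Sum.inr sum)
        else LinearMap.proj l) 0 fun x => ?_
      funext l
      have hxt : LinearMap.funLeft ℝ ℝ Sum.inl (f x) = (x : Fin d → ℝ) := funext fun i => hx x i
      by_cases hl : l = Sum.inl k₀
      · simp [f₁, hl, hxt]
      · by_cases hl' : l = Sum.inr sum <;> simp [f₁, hl, hl']
    obtain ⟨g, hg, -, hgs⟩ := smoothRealizable_add_sq_eval hσ h1 h2 k₀ hSdeg m₁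
    refine ⟨⟨fun x => ![g x (Sum.inr acc), g x (Sum.inr sum)], by fun_prop⟩,
      realizable_affine hg (LinearMap.pi ![LinearMap.proj (Sum.inr acc),
        LinearMap.proj (Sum.inr sum)]) 0 fun x => ?_, fun x => ⟨?_, ?_⟩⟩
    · ext j
      fin_cases j <;> simp
    · simp [(hgs x).1, f₁]
    · simp [(hgs x).2, f₁, hs]
      ring

end

/-- Approximation of compact subsets of the unit cube by deep zero-sets of networks with a smooth
activation function. -/
theorem exists_approximatesSets_smooth (d N : ℕ) :
    ∃ b C : ℝ, 0 < b ∧ 0 < C ∧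
      ∀ σ : ℝ → ℝ, IsRegularActivation σ → ContDiff ℝ ∞ σ →
      ∀ K : Fin N → Set (EuclideanSpace ℝ (Fin d)),
        (∀ n, (K n).Nonempty ∧ IsCompact (K n) ∧ K n ⊆ unitCube d) →
      ∀ ε : ℝ, 0 < ε → ε ≤ 1 → ∀ γ ∈ Set.Ioo (0 : ℝ) 1,
        ∃ c : FFNN N d, c.HasConstantWidth (2 * d + 2) ∧
          (c.depth : ℝ) ≤ C * (b * ε ^ (-(2 * (d : ℤ)))) ∧
          c.ApproximatesSets σ (unitCube d) γ K ε := by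
  rcases Nat.eq_zero_or_pos d with rfl | hd
  · -- in dimension zero, all `K n` are the whole space, and constants suffice
    refine ⟨1, 1, one_pos, one_pos, fun σ _ _ K hK ε _ _ γ hγ => ?_⟩
    obtain ⟨θ, hθ⟩ : γ ∈ Set.range Real.sigmoid := by rwa [Real.range_sigmoid]
    refine ⟨.output 0 fun _ => θ + 1, by simp [FFNN.HasConstantWidth], by simp [FFNN.depth], fun n => ?_⟩
    have hKn : K n = Set.univ := Subsingleton.eq_univ_of_nonempty (hK n).1
    have hZ : deepZeroSet (unitCube 0) γ
        (fun x => (FFNN.output (0 : Matrix (Fin N) (Fin 0) ℝ) fun _ => θ + 1).eval σ x) n =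
        Set.univ := by
      ext x
      rw [mem_deepZeroSet_iff hθ]
      simp [unitCube, FFNN.eval]
    rw [hKn, hZ]
    simp
  · refine ⟨1, (3 * d + 4) * (4 * d * (N + 1)) ^ d, one_pos, by positivity,
      fun σ hreg hσ K hK ε hε hε1 γ hγ => ?_⟩
    have hσ2 : ContDiff ℝ 2 σ := hσ.of_le (WithTop.coe_le_coe.2 le_top)
    obtain ⟨x₁, h1, h2⟩ := exists_deriv_ne_zero_and_deriv_deriv_ne_zero hσ2 hreg.2.1
    obtain ⟨R, hNR, hR, hR4⟩ := exists_resolution hd N hε hε1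
    obtain ⟨e⟩ : Nonempty (Fin d ⊕ SmoothReg ↪ Fin (2 * d + 2)) := by
      refine Function.Embedding.nonempty_of_card_le ?_
      simp only [Fintype.card_sum, Fintype.card_fin, show Fintype.card SmoothReg = 3 from rfl]
      omega
    obtain ⟨c, hc1, hc2, hc3⟩ := exists_approximatesSets_of_grid (σ := ⟨σ, hreg.1⟩) e ⟨0, hd⟩ hε
      hNR hR (exists_smoothRealizable_grid (σ := ⟨σ, hreg.1⟩) hσ2 h1 h2 N R (by omega) ⟨0, hd⟩)
      hK hγ
    refine ⟨c, hc1, ?_, hc3⟩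
    have hpow : R + 1 ≤ (R + 1) ^ d := Nat.le_self_pow hd.ne' _
    have hdepth : c.depth ≤ (3 * d + 4) * (R + 1) ^ d := by
      rw [hc2]
      calc d * (2 * (R + 1) + 1) + (2 * (R + 1) ^ d + 1) + 1
          ≤ d * (3 * (R + 1)) + (2 * (R + 1) ^ d + 2 * (R + 1)) := by
            have : d * (2 * (R + 1) + 1) ≤ d * (3 * (R + 1)) := by
              gcongr
              omega
            omega
        _ ≤ d * (3 * (R + 1) ^ d) + (2 * (R + 1) ^ d + 2 * (R + 1) ^ d) := by gcongr
        _ = (3 * d + 4) * (R + 1) ^ d := by ring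
    have hinv : 1 ≤ ε⁻¹ := (one_le_inv₀ hε).2 hε1
    calc (c.depth : ℝ) ≤ (3 * d + 4) * ((R : ℝ) + 1) ^ d := by exact_mod_cast hdepth
      _ ≤ (3 * d + 4) * (4 * d * (N + 1) * ε⁻¹) ^ d := by gcongr
      _ = (3 * d + 4) * (4 * d * (N + 1)) ^ d * ε⁻¹ ^ d := by rw [mul_pow]; ring
      _ ≤ (3 * d + 4) * (4 * d * (N + 1)) ^ d * ε⁻¹ ^ (2 * d) := by
        gcongr
        omega
      _ = _ := by
        rw [one_mul, zpow_neg, inv_pow]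
        norm_cast

theorem mainTheorem2 (d N : ℕ) :
    -- qualitative statement
    (∀ σ : ℝ → ℝ, IsRegularActivation σ →
      ∀ X : Set (EuclideanSpace ℝ (Fin d)), IsCompact X →
      ∀ K : Fin N → Set (EuclideanSpace ℝ (Fin d)),
        (∀ n, (K n).Nonempty ∧ IsCompact (K n) ∧ K n ⊆ X) →
      ∀ ε : ℝ, 0 < ε → ∀ γ ∈ Set.Ioo (0 : ℝ) 1,
        ∃ c : FFNN N d, c.width ≤ d + N + 2 ∧ c.ApproximatesSets σ X γ K ε) ∧
    -- ReLU networks on the unit cube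
    (2 ≤ d → ∃ b C : ℝ, 0 < b ∧ 0 < C ∧
      ∀ K : Fin N → Set (EuclideanSpace ℝ (Fin d)),
        (∀ n, (K n).Nonempty ∧ IsCompact (K n) ∧ K n ⊆ unitCube d) →
      ∀ ε : ℝ, 0 < ε → ε ≤ 1 → ∀ γ ∈ Set.Ioo (0 : ℝ) 1,
        ∃ c : FFNN N d, c.HasConstantWidth (2 * d + 10) ∧
          (c.depth : ℝ) ≤ C * (b * ε) ^ (-(d : ℤ) + 1) ∧
          c.ApproximatesSets (fun x => max 0 x) (unitCube d) γ K ε) ∧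
    -- networks with smooth activation function on the unit cube
    (∃ b C : ℝ, 0 < b ∧ 0 < C ∧
      ∀ σ : ℝ → ℝ, IsRegularActivation σ → ContDiff ℝ ∞ σ →
      ∀ K : Fin N → Set (EuclideanSpace ℝ (Fin d)),
        (∀ n, (K n).Nonempty ∧ IsCompact (K n) ∧ K n ⊆ unitCube d) →
      ∀ ε : ℝ, 0 < ε → ε ≤ 1 → ∀ γ ∈ Set.Ioo (0 : ℝ) 1,
        ∃ c : FFNN N d, c.HasConstantWidth (2 * d + 2) ∧
          (c.depth : ℝ) ≤ C * (b * ε ^ (-(2 * (d : ℤ)))) ∧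
          c.ApproximatesSets σ (unitCube d) γ K ε) :=
  ⟨fun _ hσ _ hX _ hK _ hε _ hγ => exists_approximatesSets_of_regular hσ hX hK hε hγ,
    fun hd => exists_approximatesSets_relu hd N, exists_approximatesSets_smooth d N⟩
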